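/- Let $\mathcal X$ be a measurable space, let $f:\mathcal X\to\mathbb R^d$ be a measurable embedding, and let $p_g$ (generator) and $p_{\mathrm r}$ (real data) be probability distributions on $\mathcal X$. Suppose that $\|f(X_g)\|_2\le C$ almost surely for $X_g\sim p_g$, where $C>0$, and that $f(X_{\mathrm r})$, $X_{\mathrm r}\sim p_{\mathrm r}$, is square-integrable. Let $\mu_g,\Sigma_g$ and $\mu_{\mathrm r},\Sigma_{\mathrm r}$ be the means and covariance matrices of $f(X_g)$ and $f(X_{\mathrm r})$, and assume that $\Sigma_{\mathrm r}$ is positive definite. For a mean vector $\mu$ and a covariance matrix $\Sigma$ put $$\mathrm{FD}(\mu,\Sigma)=\|\mu-\mu_{\mathrm r}\|_2^2+\mathrm{Tr}\big[\Sigma+\Sigma_{\mathrm r}-2(\Sigma\Sigma_{\mathrm r})^{1/2}\big],$$ where $(\cdot)^{1/2}$ is the principal square root, i.e. the diagonalizable square root with nonnegative eigenvalues. Let $n\ge 1$, let $x^1,\dots,x^n$ be i.i.d. samples from $p_g$, put $\widehat\mu_g^n=\frac1n\sum_{i=1}^n f(x^i)$, $\widehat\Sigma_g^n=\frac1n\sum_{i=1}^n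 (f(x^i)-\widehat\mu_g^n)(f(x^i)-\widehat\mu_g^n)^\top$, and let $\mathrm{FD}_g=\mathrm{FD}(\mu_g,\Sigma_g)$ and $\widetilde{\mathrm{FD}}{}_g^n=\mathrm{FD}(\widehat\mu_g^n,\widehat\Sigma_g^n)$. Let $\kappa$ be any constant such that $\|y^\top(f(X_g)-\mu_g)\|_{\psi_2}\le\kappa\sqrt{y^\top\Sigma_g y}$ for all $y\in\mathbb R^d$, where $\|Z\|_{\psi_2}=\inf\{t>0:\mathbb E[\exp(Z^2/t^2)]\le 2\}$. Let $\|\cdot\|_2$ denote the spectral norm on matrices and $\mathbf r(\Sigma_g)=\mathrm{Tr}[\Sigma_g]/\|\Sigma_g\|_2$ the effective rank (read as $0$ if $\Sigma_g=0$). For $0<\delta<1$ define $$\Delta_1^n=\sqrt{\frac{2dC^2}{n}\log\Big(\frac{6d}{\delta}\Big)+\frac{\mathrm{Tr}[\Sigma_g]}{n}},\qquad \Delta_2^n=20\kappa^2\|\Sigma_g\|_2\sqrt{\frac{4\mathbf r(\Sigma_g)+\log(3/\delta)}{n}}+(\Delta_1^n)^2,$$ $$\mathcal C_g^n=2\big(\Delta_1^n+\|\widehat\mu_g^n-\mu_{\mathrm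 r}\|_2\big)\Delta_1^n+\mathrm{Tr}\big[\Sigma_{\mathrm r}^{1/2}\big]\sqrt{8\Delta_2^n}+4C^2\sqrt{\frac1{2n}\log\Big(\frac3\delta\Big)}.$$ Then, with probability at least $1-\delta$, $$\widetilde{\mathrm{FD}}{}_g^n-\mathcal C_g^n\le \mathrm{FD}_g.$$ -/

import Mathlib

open MeasureTheory ProbabilityTheory

/-- `S` is a principal square root of the real square matrix `A`: `S * S = A`, and `S` is
diagonalizable over `ℝ` with nonnegative eigenvalues. By `IsPrincipalSqrt.unique` there is at most
one such `S`, and by `exists_isPrincipalSqrt_mul` there is one for the product of a positive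
semidefinite and a positive definite matrix. -/
def IsPrincipalSqrt {d : ℕ} (A S : Matrix (Fin d) (Fin d) ℝ) : Prop :=
  S * S = A ∧ ∃ (U : (Matrix (Fin d) (Fin d) ℝ)ˣ) (D : Fin d → ℝ),
    (∀ i, 0 ≤ D i) ∧ S = U.val * Matrix.diagonal D * U⁻¹.val

theorem IsPrincipalSqrt.unique {d : ℕ} {A S T : Matrix (Fin d) (Fin d) ℝ}
    (hS : IsPrincipalSqrt A S) (hT : IsPrincipalSqrt A T) : S = T := by
  obtain ⟨hSA, U, D, hD, rfl⟩ := hS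
  obtain ⟨hTA, V, E, hE, rfl⟩ := hT
  have h2 : Matrix.diagonal D * (Matrix.diagonal D * (U⁻¹.val * V.val))
      = U⁻¹.val * V.val * Matrix.diagonal E * Matrix.diagonal E := by
    have h := congrArg (fun M => U⁻¹.val * M * V.val) (hSA.trans hTA.symm)
    simpa [mul_assoc] using h
  have h1 : Matrix.diagonal D * (U⁻¹.val * V.val) = (U⁻¹.val * V.val) * Matrix.diagonal E := by
    ext i j
    have h := congrFun (congrFun h2 i) j
    simp only [Matrix.diagonal_mul, Matrix.mul_diagonal] at h ⊢
    rcases eq_or_ne ((U⁻¹.val * V.val) i j) 0 with h0 | h0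
    · rw [h0, mul_zero, zero_mul]
    · have h3 : D i ^ 2 = E j ^ 2 := by
        apply mul_right_cancel₀ h0
        linear_combination h
      rw [(sq_eq_sq₀ (hD i) (hE j)).1 h3, mul_comm]
  have h := congrArg (fun M => U.val * M * V⁻¹.val) h1
  simpa [mul_assoc] using h

open scoped MatrixOrder Matrix.Norms.L2Operator in
theorem exists_isPrincipalSqrt_mul {d : ℕ} {A B : Matrix (Fin d) (Fin d) ℝ}
    (hA : A.PosSemidef) (hB : B.PosDef) : ∃ S, IsPrincipalSqrt (A * B) S := by
  obtain ⟨C, hC⟩ : ∃ C : (Matrix (Fin d) (Fin d) ℝ)ˣ, B = C.val.conjTranspose * C.val := by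
    obtain ⟨C, hC⟩ := CStarAlgebra.nonneg_iff_eq_star_mul_self.mp hB.posSemidef.nonneg
    have hu : IsUnit C := by
      rw [Matrix.isUnit_iff_isUnit_det]
      have := (Matrix.isUnit_iff_isUnit_det _).1 hB.isUnit
      rw [hC, Matrix.det_mul] at this
      exact isUnit_of_mul_isUnit_right this
    exact ⟨hu.unit, hC⟩
  have hM := hA.mul_mul_conjTranspose_same C.val
  set Q := Unitary.toUnits hM.1.eigenvectorUnitary
  have hspec : C.val * A * C.val.conjTranspose
      = Q.val * Matrix.diagonal hM.1.eigenvalues * Q⁻¹.val := by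
    have := hM.1.spectral_theorem
    rw [Unitary.conjStarAlgAut_apply] at this
    exact this
  refine ⟨_, ?_, C⁻¹ * Q, fun i => √(hM.1.eigenvalues i), fun i => Real.sqrt_nonneg _, rfl⟩
  have hDD : Matrix.diagonal (fun i => √(hM.1.eigenvalues i)) *
      Matrix.diagonal (fun i => √(hM.1.eigenvalues i)) = Matrix.diagonal hM.1.eigenvalues := by
    rw [Matrix.diagonal_mul_diagonal]
    congr 1
    ext i
    exact Real.mul_self_sqrt (hM.eigenvalues_nonneg i)
  have key : C⁻¹.val * (C.val * A * C.val.conjTranspose) * C.val = A * B := by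
    rw [hC]; simp [mul_assoc]
  have key2 := congrArg (fun M => C⁻¹.val * M * C.val) (hspec.trans (by rw [← hDD]))
  refine Eq.trans ?_ (key2.symm.trans key)
  simp only [mul_assoc, mul_inv_rev, inv_inv, Units.val_mul, Units.mul_inv_cancel_left,
    Units.inv_mul_cancel_left]

noncomputable section

open Classical in
/-- The principal square root `A ^ (1/2)` of a real square matrix (and `0` if there is none). -/
def matSqrt {d : ℕ} (A : Matrix (Fin d) (Fin d) ℝ) : Matrix (Fin d) (Fin d) ℝ :=
  if h : ∃ S, IsPrincipalSqrt A S then h.choose else 0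

theorem matSqrt_eq {d : ℕ} {A S : Matrix (Fin d) (Fin d) ℝ} (hS : IsPrincipalSqrt A S) :
    matSqrt A = S := by
  have h : ∃ S, IsPrincipalSqrt A S := ⟨S, hS⟩
  rw [matSqrt, dif_pos h]
  exact h.choose_spec.unique hS

/-- The spectral norm (operator norm with respect to the Euclidean norm) of a matrix. -/
def specNorm {d : ℕ} (A : Matrix (Fin d) (Fin d) ℝ) : ℝ :=
  ‖Matrix.toEuclideanCLM (n := Fin d) (𝕜 := ℝ) A‖

/-- The effective rank `Tr A / ‖A‖₂`. -/
def effRank {d : ℕ} (A : Matrix (Fin d) (Fin d) ℝ) : ℝ :=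
  A.trace / specNorm A

/-- The Fréchet distance formula
`‖m₁ - m₂‖² + Tr (S₁ + S₂ - 2 (S₁ S₂) ^ (1/2))` in terms of means and covariance matrices. -/
def frechetDist {d : ℕ} (m₁ : EuclideanSpace ℝ (Fin d)) (S₁ : Matrix (Fin d) (Fin d) ℝ)
    (m₂ : EuclideanSpace ℝ (Fin d)) (S₂ : Matrix (Fin d) (Fin d) ℝ) : ℝ :=
  ‖m₁ - m₂‖ ^ 2 + (S₁ + S₂ - (2 : ℝ) • matSqrt (S₁ * S₂)).trace

/-- The mean vector of the embedding `f` under the distribution `p`. -/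
def embMean {𝒳 : Type*} [MeasurableSpace 𝒳] {d : ℕ} (f : 𝒳 → EuclideanSpace ℝ (Fin d))
    (p : Measure 𝒳) : EuclideanSpace ℝ (Fin d) :=
  ∫ x, f x ∂p

/-- The covariance matrix of the embedding `f` under the distribution `p`. -/
def embCov {𝒳 : Type*} [MeasurableSpace 𝒳] {d : ℕ} (f : 𝒳 → EuclideanSpace ℝ (Fin d))
    (p : Measure 𝒳) : Matrix (Fin d) (Fin d) ℝ :=
  Matrix.of fun i j => cov[fun x => f x i, fun x => f x j; p]

/-- The empirical mean `n⁻¹ ∑ vᵢ`. -/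
def empMean {d n : ℕ} (v : Fin n → EuclideanSpace ℝ (Fin d)) : EuclideanSpace ℝ (Fin d) :=
  (n : ℝ)⁻¹ • ∑ i, v i

/-- The empirical covariance matrix `n⁻¹ ∑ (vᵢ - m) (vᵢ - m)ᵀ`, where `m` is the empirical mean. -/
def empCov {d n : ℕ} (v : Fin n → EuclideanSpace ℝ (Fin d)) : Matrix (Fin d) (Fin d) ℝ :=
  (n : ℝ)⁻¹ • ∑ i, Matrix.vecMulVec (v i - empMean v).ofLp (v i - empMean v).ofLp

/-- The sub-Gaussian norm `inf {t > 0 : E exp (Z² / t²) ≤ 2}`, as an extended real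
(`⊤` if there is no such `t`). -/
def psi2Norm {𝒳 : Type*} [MeasurableSpace 𝒳] (Z : 𝒳 → ℝ) (p : Measure 𝒳) : ENNReal :=
  ⨅ (t : ℝ) (_ : 0 < t) (_ : ∫⁻ x, ENNReal.ofReal (Real.exp (Z x ^ 2 / t ^ 2)) ∂p ≤ 2),
    ENNReal.ofReal t

/-- `κ` is a constant such that the centered embedding satisfies
`‖yᵀ (f - μ)‖_ψ₂ ≤ κ (yᵀ Σ y) ^ (1/2)` for all `y`, where `μ` and `Σ` are the mean vector and the
covariance matrix of `f`. -/
def IsSubGaussianConst {𝒳 : Type*} [MeasurableSpace 𝒳] {d : ℕ}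
    (f : 𝒳 → EuclideanSpace ℝ (Fin d)) (p : Measure 𝒳) (κ : ℝ) : Prop :=
  ∀ y : EuclideanSpace ℝ (Fin d),
    psi2Norm (fun x => inner ℝ y (f x - embMean f p)) p
      ≤ ENNReal.ofReal (κ * √(y.ofLp ⬝ᵥ Matrix.mulVec (embCov f p) y.ofLp))

/-- The error level `Δ₁` for the mean, at sample size `n`, confidence `δ`, norm bound `C` and
covariance matrix `S`. -/
def meanErr {d : ℕ} (n : ℕ) (δ C : ℝ) (S : Matrix (Fin d) (Fin d) ℝ) : ℝ :=
  √(2 * d * C ^ 2 / n * Real.log (6 * d / δ) + S.trace / n)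

/-- The error level `Δ₂` for the covariance matrix. -/
def covErr {d : ℕ} (n : ℕ) (δ C κ : ℝ) (S : Matrix (Fin d) (Fin d) ℝ) : ℝ :=
  20 * κ ^ 2 * specNorm S * √((4 * effRank S + Real.log (3 / δ)) / n) + meanErr n δ C S ^ 2

/-- The bonus, where `m` is the empirical mean, `S` the covariance matrix of the generator, and
`mr`, `Sr` are the mean and the covariance matrix of the real data. -/
def boundedBonus {d : ℕ} (n : ℕ) (δ C κ : ℝ) (m : EuclideanSpace ℝ (Fin d))
    (S : Matrix (Fin d) (Fin d) ℝ) (mr : EuclideanSpace ℝ (Fin d))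
    (Sr : Matrix (Fin d) (Fin d) ℝ) : ℝ :=
  2 * (meanErr n δ C S + ‖m - mr‖) * meanErr n δ C S
    + (matSqrt Sr).trace * √(8 * covErr n δ C κ S)
    + 4 * C ^ 2 * √(1 / (2 * n) * Real.log (3 / δ))

end

/-! The difference of the two Fréchet distances splits into a mean term, a trace term and a matrix
square-root term. An event of probability at most `δ / 3` is discarded for each, and the rest is
deterministic (`frechetDist_sub_boundedBonus_le`).

Mean and trace: each coordinate of `f` lies in `[-C, C]`, and `‖f - μ‖²` lies in `[0, 4C²]`, so
Hoeffding's inequality gives both bounds. The empirical trace is largest when centred at a point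
other than the empirical mean, so centring at `μ` is enough.

Square root: this term enters with a minus sign, so only an upper bound on `Σ` in terms of its
empirical version is needed. If `Σ ≤ Σ̂ + ε` in the Loewner order, then `Tr (Σ Σr)^(1/2) ≤ Tr (Σ̂
Σr)^(1/2) + √ε Tr Σr^(1/2)`. Indeed, with `Σr = R²` the matrix `Σ Σr` is similar to `R Σ R`, and the
claim becomes a trace inequality for positive semidefinite `S`, `S'`, `L` with `S² ≤ S'² + L²`.

The Loewner bound is a dimension-free lower tail estimate, proved by a PAC-Bayesian argument. For a
fixed direction, Bernstein's bound controls the exponential moment of the negated quadratic form.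
Averaging over a Gaussian prior and applying Markov's inequality once yields one event; on it, the
Donsker-Varadhan inequality with the prior translated to any `v` gives the bound for all `v`
simultaneously. Smoothing adds `‖Yᵢ‖² / β` terms, controlled by a Chernoff bound and the effective
rank. Recentring `Σ̂` at the empirical mean costs `Δ₁²`. -/

open scoped Matrix

/-! ### Trace inequalities for positive semidefinite matrices -/

namespace Matrix

variable {m : Type*}

theorem PosSemidef.isSymm {A : Matrix m m ℝ} (hA : A.PosSemidef) : Aᵀ = A := by
  simpa [conjTranspose_eq_transpose_of_trivial] using hA.isHermitian.eq

variable [Fintype m]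

theorem PosSemidef.mul_mul_same {A B : Matrix m m ℝ} (hA : A.PosSemidef) (hB : Bᵀ = B) :
    (B * A * B).PosSemidef := by
  have := hA.mul_mul_conjTranspose_same B
  rwa [conjTranspose_eq_transpose_of_trivial, hB] at this

variable [DecidableEq m]

open scoped MatrixOrder Matrix.Norms.L2Operator in
theorem PosSemidef.exists_sqrt {A : Matrix m m ℝ} (hA : A.PosSemidef) :
    ∃ R : Matrix m m ℝ, R.PosSemidef ∧ R * R = A :=
  ⟨CFC.sqrt A, Matrix.nonneg_iff_posSemidef.1 (CFC.sqrt_nonneg A), CFC.sqrt_mul_sqrt_self A hA.nonneg⟩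

theorem PosSemidef.trace_mul_nonneg {A B : Matrix m m ℝ} (hA : A.PosSemidef)
    (hB : B.PosSemidef) : 0 ≤ (A * B).trace := by
  obtain ⟨R, hR, rfl⟩ := hB.exists_sqrt
  have := (hA.mul_mul_same hR.isSymm).trace_nonneg
  rwa [mul_assoc, trace_mul_comm, mul_assoc] at this

/-- For positive semidefinite `S` and positive definite `P`,
`2 Tr S ≤ Tr (S² P⁻¹) + Tr P`. -/
theorem PosSemidef.two_mul_trace_le {S P : Matrix m m ℝ} (hS : S.PosSemidef) (hP : P.PosDef) :
    2 * S.trace ≤ (S * S * P⁻¹).trace + P.trace := by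
  have hsub : (S - P)ᵀ = S - P := by
    rw [transpose_sub, hS.isSymm, hP.posSemidef.isSymm]
  have hu : IsUnit P.det := (isUnit_iff_isUnit_det _).1 hP.isUnit
  -- Nonnegativity of the trace of `(S - P) P⁻¹ (S - P)` is the matrix form of `2s ≤ s² / p + p`.
  have h := (hP.inv.posSemidef.mul_mul_same hsub).trace_nonneg
  have e : (S - P) * P⁻¹ * (S - P) = S * P⁻¹ * S - S - S + P := by
    simp only [sub_mul, mul_sub, mul_nonsing_inv P hu, one_mul, mul_assoc, nonsing_inv_mul P hu,
      mul_one]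
    abel
  rw [e, trace_add, trace_sub, trace_sub, mul_assoc, trace_mul_comm S, mul_assoc,
    trace_mul_comm P⁻¹] at h
  linarith

/-- For positive semidefinite `S ≤ P` with `P` positive definite, `Tr (S² P⁻¹) ≤ Tr S`. -/
theorem PosSemidef.trace_mul_inv_le {S P : Matrix m m ℝ} (hS : S.PosSemidef) (hP : P.PosDef)
    (hSP : (P - S).PosSemidef) : (S * S * P⁻¹).trace ≤ S.trace := by
  have hu : IsUnit P.det := (isUnit_iff_isUnit_det _).1 hP.isUnit
  have hPi : P⁻¹ᵀ = P⁻¹ := hP.inv.posSemidef.isSymm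
  have h1 := (hS.mul_mul_conjTranspose_same (1 - S * P⁻¹)).trace_nonneg
  have h2 := (hSP.mul_mul_conjTranspose_same (S * P⁻¹)).trace_nonneg
  rw [conjTranspose_eq_transpose_of_trivial] at h1 h2
  rw [transpose_sub, transpose_mul, transpose_one, hPi, hS.isSymm] at h1
  rw [transpose_mul, hPi, hS.isSymm] at h2
  -- Writing `S - S P⁻¹ S` as a sum of two congruences of `S` and `P - S` avoids antitonicity of the
  -- inverse.
  have e : (1 - S * P⁻¹) * S * (1 - P⁻¹ * S) + S * P⁻¹ * (P - S) * (P⁻¹ * S)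
      = S - S * P⁻¹ * S := by
    have : P * (P⁻¹ * S) = S := by rw [← mul_assoc, mul_nonsing_inv P hu, one_mul]
    simp only [sub_mul, mul_sub, one_mul, mul_one, mul_assoc, this]
    abel
  have h := congrArg trace e
  rw [trace_add, trace_sub, mul_assoc S P⁻¹ S, trace_mul_comm S (P⁻¹ * S), mul_assoc P⁻¹,
    trace_mul_comm P⁻¹ (S * S)] at h
  linarith

/-- If `S² ≤ S'² + L²` then `Tr S ≤ Tr S' + Tr L`, for positive semidefinite `S`, `S'` and positive
definite `L`. -/
theorem PosSemidef.trace_le_trace_add_trace {S S' L : Matrix m m ℝ} (hS : S.PosSemidef)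
    (hS' : S'.PosSemidef) (hL : L.PosDef) (h : (S' * S' + L * L - S * S).PosSemidef) :
    S.trace ≤ S'.trace + L.trace := by
  -- With the weight `P = S' + L` the chain is `2 Tr S ≤ Tr (S² P⁻¹) + Tr P ≤ Tr (S'² P⁻¹) + Tr (L²
  -- P⁻¹) + Tr P ≤ 2 Tr P`.
  have hP : (S' + L).PosDef := PosDef.posSemidef_add hS' hL
  have h1 := hS.two_mul_trace_le hP
  have h2 := hS'.trace_mul_inv_le hP (by simpa using hL.posSemidef)
  have h3 := hL.posSemidef.trace_mul_inv_le hP (by simpa using hS')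
  have h4 := h.trace_mul_nonneg hP.inv.posSemidef
  simp only [sub_mul, add_mul, trace_sub, trace_add] at h1 h4
  linarith

end Matrix

open Matrix

/-! ### Principal square roots of products -/

theorem Matrix.PosSemidef.isPrincipalSqrt {d : ℕ} {R : Matrix (Fin d) (Fin d) ℝ}
    (hR : R.PosSemidef) : IsPrincipalSqrt (R * R) R := by
  refine ⟨rfl, Unitary.toUnits hR.1.eigenvectorUnitary, hR.1.eigenvalues,
    hR.eigenvalues_nonneg, ?_⟩
  have := hR.1.spectral_theorem
  rw [Unitary.conjStarAlgAut_apply] at this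
  exact this

theorem IsPrincipalSqrt.conj {d : ℕ} {A S : Matrix (Fin d) (Fin d) ℝ} (h : IsPrincipalSqrt A S)
    (V : (Matrix (Fin d) (Fin d) ℝ)ˣ) :
    IsPrincipalSqrt (V⁻¹.val * A * V.val) (V⁻¹.val * S * V.val) := by
  obtain ⟨hA, U, D, hD, rfl⟩ := h
  refine ⟨?_, V⁻¹ * U, D, hD, by simp [mul_assoc]⟩
  rw [← hA]
  simp [mul_assoc]

/-- Since `A R² = R⁻¹ (R A R) R`, the principal root of `A R²` is `R⁻¹ S R`, which has the trace of
`S`. This replaces a non-symmetric root by a positive semidefinite one. -/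
theorem trace_matSqrt_mul {d : ℕ} {A R S : Matrix (Fin d) (Fin d) ℝ} (hR : R.PosDef)
    (hS : S.PosSemidef) (h : S * S = R * A * R) :
    (matSqrt (A * (R * R))).trace = S.trace := by
  have hu : IsUnit R := hR.isUnit
  have key := hS.isPrincipalSqrt.conj hu.unit
  rw [h] at key
  have e : hu.unit⁻¹.val * (R * A * R) * hu.unit.val = A * (R * R) := by
    have : hu.unit⁻¹.val * R = 1 := hu.val_inv_mul
    rw [IsUnit.unit_spec, mul_assoc R A R, ← mul_assoc _ R, this, one_mul, mul_assoc]
  rw [e] at key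
  rw [matSqrt_eq key, trace_mul_comm, ← mul_assoc, hu.unit.mul_inv, one_mul]

/-- If `A ≤ A' + ε` then `Tr (A B) ^ (1/2) ≤ Tr (A' B) ^ (1/2) + ε ^ (1/2) Tr B ^ (1/2)`. -/
theorem trace_matSqrt_mul_le {d : ℕ} {A A' B : Matrix (Fin d) (Fin d) ℝ} {ε : ℝ} (hε : 0 < ε)
    (hA : A.PosSemidef) (hA' : A'.PosSemidef) (hB : B.PosDef)
    (h : (A' + ε • (1 : Matrix (Fin d) (Fin d) ℝ) - A).PosSemidef) :
    (matSqrt (A * B)).trace ≤ (matSqrt (A' * B)).trace + √ε * (matSqrt B).trace := by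
  obtain ⟨R, hR, rfl⟩ := hB.posSemidef.exists_sqrt
  have hRd : R.PosDef := by
    refine hR.posDef_iff_isUnit.2 ?_
    rw [Matrix.isUnit_iff_isUnit_det]
    have := (Matrix.isUnit_iff_isUnit_det _).1 hB.isUnit
    rw [Matrix.det_mul] at this
    exact isUnit_of_mul_isUnit_right this
  obtain ⟨S, hS, hSe⟩ := (hA.mul_mul_same hR.isSymm).exists_sqrt
  obtain ⟨S', hS', hSe'⟩ := (hA'.mul_mul_same hR.isSymm).exists_sqrt
  rw [trace_matSqrt_mul hRd hS hSe, trace_matSqrt_mul hRd hS' hSe',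
    matSqrt_eq hR.isPrincipalSqrt]
  -- Conjugating the hypothesis by `R` gives `S² ≤ S'² + (√ε R)²`; strict positivity of `ε` makes
  -- `√ε R` definite.
  have hL : (√ε • R).PosDef := hRd.smul (Real.sqrt_pos.2 hε)
  have key := hS.trace_le_trace_add_trace hS' hL ?_
  · simpa using key
  · have := h.mul_mul_same hR.isSymm
    rw [hSe, hSe']
    convert this using 1
    simp only [smul_mul_assoc, mul_smul_comm, smul_smul, Real.mul_self_sqrt hε.le, mul_sub,
      sub_mul, mul_add, add_mul, mul_one]

theorem matSqrt_trace_nonneg {d : ℕ} {B : Matrix (Fin d) (Fin d) ℝ} (hB : B.PosSemidef) :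
    0 ≤ (matSqrt B).trace := by
  obtain ⟨R, hR, rfl⟩ := hB.exists_sqrt
  rw [matSqrt_eq hR.isPrincipalSqrt]
  exact hR.trace_nonneg

/-! ### Gaussian translations and moments of Gaussian quadratic forms -/

/-- Cauchy-Schwarz weighted by `‖b k‖`: a fourth moment of order `‖b k‖⁴` then contributes `‖b k‖²`,
so the resulting Gaussian bound depends on `∑ ‖b k‖²` and not on the number of terms. -/
theorem sq_sum_inner_sq_le {E : Type*} [NormedAddCommGroup E] [InnerProductSpace ℝ E] {ι : Type*}
    [Fintype ι] (b : ι → E) (x : E) : (∑ k, inner ℝ (b k) x ^ 2) ^ 2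
      ≤ (∑ k, ‖b k‖ ^ 2) * ∑ k, (‖b k‖ ^ 2)⁻¹ * inner ℝ (b k) x ^ 4 := by
  have h := Finset.sum_mul_sq_le_sq_mul_sq Finset.univ (fun k => ‖b k‖)
    (fun k => ‖b k‖⁻¹ * inner ℝ (b k) x ^ 2)
  have e1 : ∀ k, ‖b k‖ * (‖b k‖⁻¹ * inner ℝ (b k) x ^ 2) = inner ℝ (b k) x ^ 2 := by
    intro k
    rcases eq_or_ne (b k) 0 with h0 | h0
    · simp [h0]
    · rw [mul_inv_cancel_left₀ (norm_ne_zero_iff.2 h0)]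
  have e2 : ∀ k, (‖b k‖⁻¹ * inner ℝ (b k) x ^ 2) ^ 2
      = (‖b k‖ ^ 2)⁻¹ * inner ℝ (b k) x ^ 4 := by
    intro k
    rw [mul_pow, inv_pow, ← pow_mul]
  simpa only [e1, e2] using h

namespace ProbabilityTheory

variable {E : Type*} [NormedAddCommGroup E] [InnerProductSpace ℝ E] [FiniteDimensional ℝ E]
  [MeasurableSpace E] [BorelSpace E]

theorem stdGaussian_eq_withDensity :
    stdGaussian E = (volume : Measure E).withDensity fun x =>
      ENNReal.ofReal (((2 * Real.pi) ^ (Module.finrank ℝ E / 2 : ℝ))⁻¹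
        * Real.exp (-‖x‖ ^ 2 / 2)) := by
  set c : ℝ := ((2 * Real.pi) ^ (Module.finrank ℝ E / 2 : ℝ))⁻¹ with hc
  have hc0 : 0 < c := by positivity
  have hint : Integrable (fun x : E => c * Real.exp (-‖x‖ ^ 2 / 2)) := by
    refine Integrable.const_mul ?_ c
    have h := GaussianFourier.integrable_cexp_neg_mul_sq_norm_add (V := E) (b := 1 / 2)
      (by norm_num) 0 0
    refine h.norm.congr (.of_forall fun x => ?_)
    simp only [Complex.norm_exp]
    congr 1
    simp [← Complex.ofReal_pow]
    ring
  have : IsFiniteMeasure ((volume : Measure E).withDensity fun x =>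
      ENNReal.ofReal (c * Real.exp (-‖x‖ ^ 2 / 2))) :=
    isFiniteMeasure_withDensity_ofReal hint.2
  refine Measure.ext_of_charFun ?_
  ext t
  rw [charFun_stdGaussian, charFun_apply, integral_withDensity_eq_integral_toReal_smul
    (by fun_prop) (by simp)]
  have h := GaussianFourier.integral_cexp_neg_mul_sq_norm_add (V := E) (b := 1 / 2)
      (by norm_num) Complex.I t
  have e : ∀ x : E, (ENNReal.ofReal (c * Real.exp (-‖x‖ ^ 2 / 2))).toReal •
      Complex.exp (inner ℝ x t * Complex.I)
      = c * Complex.exp (-(1 / 2) * ‖x‖ ^ 2 + Complex.I * inner ℝ t x) := by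
    intro x
    rw [ENNReal.toReal_ofReal (by positivity), Complex.real_smul, real_inner_comm, Complex.exp_add]
    push_cast
    rw [mul_assoc]
    congr 2
    · congr 1; ring
    · rw [mul_comm]
  simp_rw [e]
  rw [integral_const_mul, h, hc, ← mul_assoc]
  have : ((((2 * Real.pi) ^ (Module.finrank ℝ E / 2 : ℝ))⁻¹ : ℝ) : ℂ) *
      (Real.pi / (1 / 2)) ^ (Module.finrank ℝ E / 2 : ℂ) = 1 := by
    rw [Complex.ofReal_inv, Complex.ofReal_cpow (by positivity)]
    push_cast
    rw [show (Real.pi / (1 / 2) : ℂ) = 2 * Real.pi by ring]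
    refine inv_mul_cancel₀ ?_
    rw [Complex.cpow_ne_zero_iff]
    left
    simp [Real.pi_ne_zero]
  rw [this, one_mul, Complex.I_sq]
  congr 1
  ring

/-- The Cameron-Martin formula, read off from the density and translation invariance of Lebesgue
measure. -/
theorem lintegral_stdGaussian_eq_lintegral_add {F : E → ENNReal} (hF : Measurable F) (v : E) :
    ∫⁻ x, F x ∂(stdGaussian E) =
      ∫⁻ x, F (v + x) * ENNReal.ofReal (Real.exp (-inner ℝ v x - ‖v‖ ^ 2 / 2))
        ∂(stdGaussian E) := by
  rw [stdGaussian_eq_withDensity, lintegral_withDensity_eq_lintegral_mul _ (by fun_prop) hF,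
    lintegral_withDensity_eq_lintegral_mul _ (by fun_prop) (by fun_prop),
    ← lintegral_add_left_eq_self _ v]
  refine lintegral_congr fun x => ?_
  simp only [Pi.mul_apply]
  rw [mul_comm (F _), ← mul_assoc, ← ENNReal.ofReal_mul (by positivity), mul_assoc, ← Real.exp_add,
    norm_add_sq_real]
  congr 4
  ring

/-- The Donsker-Varadhan inequality for translates of the standard Gaussian measure. -/
theorem ofReal_exp_integral_add_le {h : E → ℝ} (hh : Measurable h) (v : E)
    (hint : Integrable (fun x => h (v + x)) (stdGaussian E)) :
    ENNReal.ofReal (Real.exp (∫ x, h (v + x) ∂(stdGaussian E) - ‖v‖ ^ 2 / 2)) ≤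
      ∫⁻ x, ENNReal.ofReal (Real.exp (h x)) ∂(stdGaussian E) := by
  have hL : Integrable (fun x : E => inner ℝ v x) (stdGaussian E) :=
    (IsGaussian.integrable_dual (stdGaussian E) (innerSL ℝ v))
  have hL0 : ∫ x : E, inner ℝ v x ∂(stdGaussian E) = 0 :=
    integral_strongDual_stdGaussian (innerSL ℝ v)
  rw [lintegral_stdGaussian_eq_lintegral_add (by fun_prop) v]
  simp_rw [← ENNReal.ofReal_mul (Real.exp_nonneg _), ← Real.exp_add]
  set k : E → ℝ := fun x => h (v + x) + (-inner ℝ v x - ‖v‖ ^ 2 / 2) with hk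
  have hkint : Integrable k (stdGaussian E) :=
    hint.add (hL.neg.sub (integrable_const _))
  have hki : ∫ x, k x ∂(stdGaussian E) = ∫ x, h (v + x) ∂(stdGaussian E) - ‖v‖ ^ 2 / 2 := by
    have h1 : ∫ x, k x ∂(stdGaussian E) = ∫ x, h (v + x) ∂(stdGaussian E)
        + ∫ x, (-inner ℝ v x - ‖v‖ ^ 2 / 2) ∂(stdGaussian E) :=
      integral_add hint (hL.neg.sub (integrable_const _))
    have h2 : ∫ x, (-inner ℝ v x - ‖v‖ ^ 2 / 2) ∂(stdGaussian E)
        = ∫ x, -inner ℝ v x ∂(stdGaussian E) - ∫ _, ‖v‖ ^ 2 / 2 ∂(stdGaussian E) :=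
      integral_sub hL.neg (integrable_const _)
    rw [h1, h2, integral_neg, hL0]
    simp
    ring
  rw [← hki]
  have hkm : AEStronglyMeasurable (fun x => Real.exp (k x)) (stdGaussian E) :=
    Real.continuous_exp.comp_aestronglyMeasurable hkint.1
  by_cases hfin : ∫⁻ x, ENNReal.ofReal (Real.exp (k x)) ∂(stdGaussian E) = ⊤
  · rw [hfin]; exact le_top
  have hexp : Integrable (fun x => Real.exp (k x)) (stdGaussian E) := by
    refine ⟨hkm, ?_⟩
    rw [hasFiniteIntegral_iff_ofReal (.of_forall fun x => Real.exp_nonneg _)]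
    exact lt_top_iff_ne_top.2 hfin
  rw [← ofReal_integral_eq_lintegral_ofReal hexp (.of_forall fun x => Real.exp_nonneg _)]
  -- Jensen's inequality; the centred linear term integrates to zero, leaving the relative entropy
  -- `‖v‖² / 2` of the translate.
  exact ENNReal.ofReal_le_ofReal (convexOn_exp.map_integral_le Real.continuous_exp.continuousOn
    isClosed_univ (by simp) hkint hexp)

theorem map_inner_stdGaussian (a : E) :
    (stdGaussian E).map (fun x => inner ℝ a x) = gaussianReal 0 (‖a‖₊ ^ 2) := by
  have h := IsGaussian.map_eq_gaussianReal (μ := stdGaussian E) (innerSL ℝ a)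
  rw [integral_strongDual_stdGaussian, variance_dual_stdGaussian, innerSL_apply_norm] at h
  have e : (‖a‖ ^ 2).toNNReal = ‖a‖₊ ^ 2 := by
    rw [Real.toNNReal_pow (norm_nonneg _), norm_toNNReal]
  rw [e] at h
  exact h

theorem memLp_inner_stdGaussian (a : E) (p : NNReal) :
    MemLp (fun x : E => inner ℝ a x) p (stdGaussian E) :=
  IsGaussian.memLp_dual (stdGaussian E) (innerSL ℝ a) p (by simp)

theorem integrable_inner_pow_stdGaussian (a : E) (k : ℕ) :
    Integrable (fun x : E => inner ℝ a x ^ k) (stdGaussian E) := by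
  have := (memLp_inner_stdGaussian a k).integrable_norm_pow'
  refine this.mono' (by fun_prop) (.of_forall fun x => ?_)
  rw [norm_pow]

theorem integral_inner_sq_stdGaussian (a : E) :
    ∫ x : E, inner ℝ a x ^ 2 ∂(stdGaussian E) = ‖a‖ ^ 2 := by
  have h := variance_dual_stdGaussian (innerSL ℝ a)
  rw [variance_of_integral_eq_zero (by fun_prop) (integral_strongDual_stdGaussian _),
    innerSL_apply_norm] at h
  exact h

theorem _root_.Real.pow_four_le_cosh (x : ℝ) : x ^ 4 ≤ 24 * (Real.cosh x - 1 - x ^ 2 / 2) := by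
  have h := sum_le_hasSum (Finset.range 3) (fun i _ => by rw [pow_mul]; positivity)
    (Real.hasSum_cosh x)
  simp [Finset.sum_range_succ, Nat.factorial] at h
  linarith

/-- The fourth power is dominated by the tail of the `cosh` series, and `E cosh g = exp (1/2)` is
known from the Gaussian moment generating function. This gives 4 in place of the exact 3, which is
enough later. -/
theorem integral_inner_pow_four_stdGaussian_le (a : E) :
    ∫ x : E, inner ℝ a x ^ 4 ∂(stdGaussian E) ≤ 4 * ‖a‖ ^ 4 := by
  have unit : ∀ b : E, ‖b‖ = 1 → ∫ x : E, inner ℝ b x ^ 4 ∂(stdGaussian E) ≤ 4 := by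
    intro b hb
    have hm : ∀ s : ℝ, ∫ x : E, Real.exp (s * inner ℝ b x) ∂(stdGaussian E)
        = Real.exp (s ^ 2 / 2) := by
      intro s
      have := mgf_gaussianReal (map_inner_stdGaussian b) s
      rw [mgf] at this
      rw [this]
      simp [hb]
    have hi : ∀ s : ℝ, Integrable (fun x : E => Real.exp (s * inner ℝ b x)) (stdGaussian E) := by
      intro s
      -- A non-integrable function has integral 0 by convention, whereas this integral equals a
      -- positive exponential.
      by_contra hcon
      have h1 := hm s
      rw [integral_undef hcon] at h1
      exact (Real.exp_pos _).ne h1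
    have h1 := hm 1
    have h2 := hm (-1)
    have hcosh : ∀ x : E, Real.cosh (inner ℝ b x)
        = (Real.exp (1 * inner ℝ b x) + Real.exp (-1 * inner ℝ b x)) / 2 := by
      intro x; rw [Real.cosh_eq]; simp
    have hci : Integrable (fun x : E => Real.cosh (inner ℝ b x)) (stdGaussian E) := by
      simp_rw [hcosh]
      exact ((hi 1).add (hi (-1))).div_const 2
    have hcv : ∫ x : E, Real.cosh (inner ℝ b x) ∂(stdGaussian E) = Real.exp (1 / 2) := by
      simp_rw [hcosh]
      rw [integral_div, integral_add (hi 1) (hi (-1)), h1, h2]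
      norm_num
    have i2 := integrable_inner_pow_stdGaussian b 2
    calc ∫ x : E, inner ℝ b x ^ 4 ∂(stdGaussian E)
        ≤ ∫ x : E, 24 * (Real.cosh (inner ℝ b x) - 1 - inner ℝ b x ^ 2 / 2) ∂(stdGaussian E) :=
          integral_mono (integrable_inner_pow_stdGaussian b 4)
            (((hci.sub (integrable_const _)).sub (i2.div_const 2)).const_mul 24)
            fun x => Real.pow_four_le_cosh _
      _ = 24 * (Real.exp (1 / 2) - 1 - 1 / 2) := by
          have e1 : ∫ x : E, (Real.cosh (inner ℝ b x) - 1 - inner ℝ b x ^ 2 / 2) ∂(stdGaussian E)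
              = ∫ x : E, (Real.cosh (inner ℝ b x) - 1) ∂(stdGaussian E)
                - ∫ x : E, inner ℝ b x ^ 2 / 2 ∂(stdGaussian E) :=
            integral_sub (hci.sub (integrable_const _)) (i2.div_const 2)
          rw [integral_const_mul, e1, integral_sub hci (integrable_const _), hcv, integral_div,
            integral_inner_sq_stdGaussian, hb]
          simp
      _ ≤ 4 := by
          have : Real.exp (1 / 2) ≤ 1.66 := by
            have h3 : Real.exp (1 / 2) ^ 2 = Real.exp 1 := by
              rw [← Real.exp_nat_mul]; norm_num
            refine (pow_le_pow_iff_left₀ (Real.exp_nonneg _) (by norm_num) two_ne_zero).1 ?_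
            rw [h3]
            linarith [Real.exp_one_lt_d9]
          linarith
  rcases eq_or_ne a 0 with rfl | ha
  · simp
  · have hn : ‖a‖ ≠ 0 := norm_ne_zero_iff.2 ha
    have h := unit (‖a‖⁻¹ • a) (by rw [norm_smul, norm_inv, norm_norm, inv_mul_cancel₀ hn])
    simp_rw [inner_smul_left, mul_pow] at h
    rw [integral_const_mul] at h
    simp only [conj_trivial, inv_pow] at h
    rwa [inv_mul_le_iff₀ (by positivity), mul_comm] at h

theorem integrable_sq_sum_inner_sq_stdGaussian {ι : Type*} [Fintype ι] (b : ι → E) :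
    Integrable (fun x : E => (∑ k, inner ℝ (b k) x ^ 2) ^ 2) (stdGaussian E) := by
  refine Integrable.mono' (g := fun x => (∑ k, ‖b k‖ ^ 2) *
    ∑ k, (‖b k‖ ^ 2)⁻¹ * inner ℝ (b k) x ^ 4) ?_ (by fun_prop) (.of_forall fun x => ?_)
  · exact (integrable_finsetSum _ fun k _ =>
      (integrable_inner_pow_stdGaussian (b k) 4).const_mul _).const_mul _
  · rw [Real.norm_of_nonneg (by positivity)]
    exact sq_sum_inner_sq_le b x

theorem integral_sum_inner_sq_sq_stdGaussian_le {ι : Type*} [Fintype ι] (b : ι → E) :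
    ∫ x : E, (∑ k, inner ℝ (b k) x ^ 2) ^ 2 ∂(stdGaussian E) ≤ 4 * (∑ k, ‖b k‖ ^ 2) ^ 2 := by
  have hi : ∀ k, Integrable (fun x : E => (‖b k‖ ^ 2)⁻¹ * inner ℝ (b k) x ^ 4) (stdGaussian E) :=
    fun k => (integrable_inner_pow_stdGaussian (b k) 4).const_mul _
  calc ∫ x : E, (∑ k, inner ℝ (b k) x ^ 2) ^ 2 ∂(stdGaussian E)
      ≤ ∫ x : E, (∑ k, ‖b k‖ ^ 2) * ∑ k, (‖b k‖ ^ 2)⁻¹ * inner ℝ (b k) x ^ 4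
          ∂(stdGaussian E) := by
        refine integral_mono_of_nonneg (.of_forall fun x => by positivity)
          ((integrable_finsetSum _ fun k _ => hi k).const_mul _) (.of_forall fun x => sq_sum_inner_sq_le b x)
    _ ≤ (∑ k, ‖b k‖ ^ 2) * ∑ k, 4 * ‖b k‖ ^ 2 := by
        rw [integral_const_mul, integral_finsetSum _ fun k _ => hi k]
        gcongr with k
        rw [integral_const_mul]
        have := integral_inner_pow_four_stdGaussian_le (b k)
        rcases eq_or_ne (b k) 0 with h0 | h0
        · simp [h0]
        · have : 0 < ‖b k‖ := norm_pos_iff.2 h0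
          rw [inv_mul_le_iff₀ (by positivity)]
          linarith
    _ = 4 * (∑ k, ‖b k‖ ^ 2) ^ 2 := by
        rw [← Finset.mul_sum]; ring

end ProbabilityTheory

/-! ### Exponential moments of sub-Gaussian variables -/

theorem Real.exp_neg_le_quadratic {x : ℝ} (hx : 0 ≤ x) : Real.exp (-x) ≤ 1 - x + x ^ 2 / 2 := by
  have h := Real.quadratic_le_exp_of_nonneg hx
  have h0 : 0 < 1 - x + x ^ 2 / 2 := by nlinarith [sq_nonneg (x - 1)]
  rw [Real.exp_neg, inv_le_comm₀ (Real.exp_pos _) h0]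
  refine le_trans ?_ h
  rw [inv_le_iff_one_le_mul₀ h0]
  -- `(1 - x + x²/2)(1 + x + x²/2) = 1 + x⁴/4`.
  nlinarith [sq_nonneg (x ^ 2)]

/-- For `0 ≤ a ≤ 1` compare power series, using `a ^ n ≤ a ^ 2` for `n ≥ 2`; for `a ≤ 0` use the
quadratic bounds. Covering both signs lets one lemma serve upper and lower tails. -/
theorem Real.exp_mul_le_of_le_one {a u : ℝ} (hu : 0 ≤ u) (ha : a ≤ 1) :
    Real.exp (a * u) ≤ 1 + a * u + a ^ 2 * (Real.exp u - 1 - u) := by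
  rcases le_total 0 a with h0 | h0
  · have hs : ∀ x : ℝ, HasSum (fun n : ℕ => x ^ n / n.factorial) (Real.exp x) := fun x => by
      rw [Real.exp_eq_exp_ℝ]; exact NormedSpace.expSeries_div_hasSum_exp x
    have h1 := ((hs u).mul_left (a ^ 2)).add
      ((hasSum_ite_eq (0 : ℕ) (1 - a ^ 2)).add (hasSum_ite_eq (1 : ℕ) ((a - a ^ 2) * u)))
    refine (hasSum_le (fun n => ?_) (hs (a * u)) h1).trans_eq (by ring)
    match n with
    | 0 => simp
    | 1 => simp; linarith
    | n + 2 =>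
      simp only [Nat.add_eq_zero_iff, OfNat.ofNat_ne_zero, and_false, if_false, add_zero,
        show n + 2 ≠ 1 by omega]
      rw [← mul_div_assoc, mul_pow]
      gcongr ?_ * _ / _
      exact pow_le_pow_of_le_one h0 ha (by omega)
  · have h1 := Real.exp_neg_le_quadratic (x := -(a * u)) (by nlinarith)
    rw [neg_neg] at h1
    have h2 := Real.quadratic_le_exp_of_nonneg hu
    nlinarith [sq_nonneg a]

namespace ProbabilityTheory

variable {𝒳 : Type*} [MeasurableSpace 𝒳] {p : Measure 𝒳}

theorem integrable_exp_of_lintegral_le {U : 𝒳 → ℝ} (hU : Measurable U)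
    (h : ∫⁻ x, ENNReal.ofReal (Real.exp (U x)) ∂p ≤ 2) :
    Integrable (fun x => Real.exp (U x)) p ∧ ∫ x, Real.exp (U x) ∂p ≤ 2 := by
  have hi : Integrable (fun x => Real.exp (U x)) p := by
    refine ⟨by fun_prop, ?_⟩
    rw [hasFiniteIntegral_iff_ofReal (.of_forall fun x => Real.exp_nonneg _)]
    exact h.trans_lt (by simp)
  refine ⟨hi, ?_⟩
  rw [integral_eq_lintegral_of_nonneg_ae (.of_forall fun x => Real.exp_nonneg _) hi.1]
  exact ENNReal.toReal_le_of_le_ofReal (by norm_num) (by simpa using h)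

theorem lintegral_exp_sq_div_sq_le_of_psi2Norm_lt {Z : 𝒳 → ℝ} {t : ℝ}
    (h : psi2Norm Z p < ENNReal.ofReal t) :
    ∫⁻ x, ENNReal.ofReal (Real.exp (Z x ^ 2 / t ^ 2)) ∂p ≤ 2 := by
  simp only [psi2Norm, iInf_lt_iff] at h
  obtain ⟨s, hs0, hs, hst⟩ := h
  have hst' : s < t := ((ENNReal.ofReal_lt_ofReal_iff_of_nonneg hs0.le).1 hst)
  refine le_trans (lintegral_mono fun x => ENNReal.ofReal_le_ofReal ?_) hs
  gcongr

theorem integrable_of_lintegral_exp_le {U : 𝒳 → ℝ} (hU : Measurable U) (hU0 : ∀ x, 0 ≤ U x)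
    (h : ∫⁻ x, ENNReal.ofReal (Real.exp (U x)) ∂p ≤ 2) : Integrable U p := by
  refine (integrable_exp_of_lintegral_le hU h).1.mono' (by fun_prop) (.of_forall fun x => ?_)
  rw [Real.norm_of_nonneg (hU0 x)]
  linarith [Real.add_one_le_exp (U x)]

variable [IsProbabilityMeasure p]

theorem integral_le_one_of_lintegral_exp_le {U : 𝒳 → ℝ} (hU : Measurable U) (hU0 : ∀ x, 0 ≤ U x)
    (h : ∫⁻ x, ENNReal.ofReal (Real.exp (U x)) ∂p ≤ 2) : ∫ x, U x ∂p ≤ 1 := by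
  obtain ⟨hi, hi2⟩ := integrable_exp_of_lintegral_le hU h
  have hUi := integrable_of_lintegral_exp_le hU hU0 h
  have h1 : ∫ x, (U x + 1) ∂p ≤ ∫ x, Real.exp (U x) ∂p :=
    integral_mono (hUi.add (integrable_const _)) hi fun x => Real.add_one_le_exp (U x)
  rw [integral_add hUi (integrable_const _)] at h1
  simp at h1
  linarith

/-- A Bernstein-type bound for the moment generating function of a nonnegative variable `U` with
`E exp U ≤ 2`. -/
theorem lintegral_exp_mul_le {U : 𝒳 → ℝ} (hU : Measurable U) (hU0 : ∀ x, 0 ≤ U x)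
    (h : ∫⁻ x, ENNReal.ofReal (Real.exp (U x)) ∂p ≤ 2) {a : ℝ} (ha : a ≤ 1) :
    ∫⁻ x, ENNReal.ofReal (Real.exp (a * U x)) ∂p
      ≤ ENNReal.ofReal (Real.exp (a * ∫ x, U x ∂p + a ^ 2)) := by
  obtain ⟨hi, hi2⟩ := integrable_exp_of_lintegral_le hU h
  have hUi := integrable_of_lintegral_exp_le hU hU0 h
  have hm : 0 ≤ ∫ x, U x ∂p := integral_nonneg hU0
  have i1 : Integrable (fun x => 1 + a * U x) p := (integrable_const _).add (hUi.const_mul a)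
  have i2 : Integrable (fun x => Real.exp (U x) - 1) p := hi.sub (integrable_const _)
  have i3 : Integrable (fun x => Real.exp (U x) - 1 - U x) p := i2.sub hUi
  have hG : Integrable (fun x => 1 + a * U x + a ^ 2 * (Real.exp (U x) - 1 - U x)) p :=
    i1.add (i3.const_mul _)
  calc ∫⁻ x, ENNReal.ofReal (Real.exp (a * U x)) ∂p
      ≤ ∫⁻ x, ENNReal.ofReal (1 + a * U x + a ^ 2 * (Real.exp (U x) - 1 - U x)) ∂p :=
        lintegral_mono fun x => ENNReal.ofReal_le_ofReal (Real.exp_mul_le_of_le_one (hU0 x) ha)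
    _ = ENNReal.ofReal (∫ x, (1 + a * U x + a ^ 2 * (Real.exp (U x) - 1 - U x)) ∂p) :=
        (ofReal_integral_eq_lintegral_ofReal hG (.of_forall fun x =>
          (Real.exp_nonneg _).trans (Real.exp_mul_le_of_le_one (hU0 x) ha))).symm
    _ ≤ _ := by
        refine ENNReal.ofReal_le_ofReal ?_
        rw [integral_add i1 (i3.const_mul _), integral_add (integrable_const _) (hUi.const_mul a),
          integral_const_mul, integral_const_mul, integral_sub i2 hUi,
          integral_sub hi (integrable_const _)]
        simp only [integral_const, probReal_univ, smul_eq_mul, mul_one]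
        have := Real.add_one_le_exp (a * ∫ x, U x ∂p + a ^ 2)
        nlinarith [sq_nonneg a]

/-- If `E exp (Z² / (K s)) ≤ 2` where `s = E Z²`, then the lower tail of `Z²` is sub-Gaussian. -/
theorem lintegral_exp_neg_mul_sq_le {Z : 𝒳 → ℝ} (hZ : Measurable Z) {K s l : ℝ} (hK : 0 < K)
    (hl : 0 ≤ l) (hs : ∫ x, Z x ^ 2 ∂p = s)
    (h : ∫⁻ x, ENNReal.ofReal (Real.exp (Z x ^ 2 / (K * s))) ∂p ≤ 2) :
    ∫⁻ x, ENNReal.ofReal (Real.exp (-l * Z x ^ 2)) ∂p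
      ≤ ENNReal.ofReal (Real.exp (-l * s + (l * K) ^ 2 * s ^ 2)) := by
  have hs0 : 0 ≤ s := hs ▸ integral_nonneg fun x => sq_nonneg _
  rcases hs0.eq_or_lt with rfl | hpos
  · calc ∫⁻ x, ENNReal.ofReal (Real.exp (-l * Z x ^ 2)) ∂p ≤ ∫⁻ _, 1 ∂p := by
          refine lintegral_mono fun x => ?_
          rw [ENNReal.ofReal_le_one, Real.exp_le_one_iff]
          nlinarith [sq_nonneg (Z x)]
      _ ≤ _ := by simp
  -- A negative multiplier satisfies `a ≤ 1` whatever its size, so the lower tail needs no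
  -- restriction on `l`.
  · have key := lintegral_exp_mul_le (U := fun x => Z x ^ 2 / (K * s)) (by fun_prop)
      (fun x => by positivity) h (a := -(l * K * s)) (by
        have : 0 ≤ l * K * s := by positivity
        linarith)
    rw [integral_div, hs] at key
    have e : ∀ w, -(l * K * s) * (w / (K * s)) = -l * w := fun w => by field_simp
    simp only [e] at key
    rwa [neg_sq, mul_pow (l * K)] at key

end ProbabilityTheory

/-! ### The PAC-Bayesian bound for quadratic forms -/

namespace ProbabilityTheory

theorem sq_sum_inner_add_smul_sq_le {E : Type*} [NormedAddCommGroup E] [InnerProductSpace ℝ E]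
    {ι : Type*} [Fintype ι] (b : ι → E) (v x : E) (c : ℝ) :
    (∑ k, inner ℝ (b k) (v + c • x) ^ 2) ^ 2
      ≤ 8 * (∑ k, inner ℝ (b k) v ^ 2) ^ 2 + 8 * c ^ 4 * (∑ k, inner ℝ (b k) x ^ 2) ^ 2 := by
  have h : ∑ k, inner ℝ (b k) (v + c • x) ^ 2
      ≤ 2 * ∑ k, inner ℝ (b k) v ^ 2 + 2 * c ^ 2 * ∑ k, inner ℝ (b k) x ^ 2 := by
    rw [Finset.mul_sum, Finset.mul_sum, ← Finset.sum_add_distrib]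
    refine Finset.sum_le_sum fun k _ => ?_
    rw [inner_add_right, inner_smul_right]
    nlinarith [sq_nonneg (inner ℝ (b k) v - c * inner ℝ (b k) x)]
  have h0 : 0 ≤ ∑ k, inner ℝ (b k) (v + c • x) ^ 2 := Finset.sum_nonneg fun k _ => sq_nonneg _
  refine (pow_le_pow_left₀ h0 h 2).trans ?_
  nlinarith [sq_nonneg (∑ k, inner ℝ (b k) v ^ 2 - c ^ 2 * ∑ k, inner ℝ (b k) x ^ 2)]

section Variational

variable {E : Type*} [NormedAddCommGroup E] [InnerProductSpace ℝ E] [FiniteDimensional ℝ E]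
  [MeasurableSpace E] [BorelSpace E]

theorem integrable_inner_add_smul_sq_stdGaussian (a v : E) (c : ℝ) :
    Integrable (fun x : E => inner ℝ a (v + c • x) ^ 2) (stdGaussian E) := by
  have h1 := integrable_inner_pow_stdGaussian a 1
  have h2 := integrable_inner_pow_stdGaussian a 2
  refine (((integrable_const (inner ℝ a v ^ 2)).add (h1.const_mul (2 * inner ℝ a v * c))).add
    (h2.const_mul (c ^ 2))).congr (.of_forall fun x => ?_)
  simp only [Pi.add_apply, inner_add_right, inner_smul_right]
  ring

theorem integral_inner_add_smul_sq_stdGaussian (a v : E) (c : ℝ) :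
    ∫ x : E, inner ℝ a (v + c • x) ^ 2 ∂(stdGaussian E)
      = inner ℝ a v ^ 2 + c ^ 2 * ‖a‖ ^ 2 := by
  have h1 : Integrable (fun x : E => inner ℝ a x) (stdGaussian E) := by
    simpa using integrable_inner_pow_stdGaussian a 1
  have h2 := integrable_inner_pow_stdGaussian a 2
  have h0 : ∫ x : E, inner ℝ a x ∂(stdGaussian E) = 0 :=
    integral_strongDual_stdGaussian (innerSL ℝ a)
  have e : ∀ x : E, inner ℝ a (v + c • x) ^ 2
      = inner ℝ a v ^ 2 + 2 * inner ℝ a v * c * inner ℝ a x + c ^ 2 * inner ℝ a x ^ 2 := by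
    intro x
    simp only [inner_add_right, inner_smul_right]
    ring
  have h3 : Integrable (fun x : E => inner ℝ a v ^ 2 + 2 * inner ℝ a v * c * inner ℝ a x)
      (stdGaussian E) := (integrable_const _).add (h1.const_mul _)
  simp_rw [e]
  rw [integral_add h3 (h2.const_mul _), integral_add (integrable_const _) (h1.const_mul _), integral_const_mul, integral_const_mul, h0,
    integral_inner_sq_stdGaussian]
  simp

theorem integral_sum_inner_add_smul_sq_stdGaussian {ι : Type*} [Fintype ι] (b : ι → E) (v : E)
    (c : ℝ) : ∫ x : E, ∑ k, inner ℝ (b k) (v + c • x) ^ 2 ∂(stdGaussian E)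
      = ∑ k, inner ℝ (b k) v ^ 2 + c ^ 2 * ∑ k, ‖b k‖ ^ 2 := by
  rw [integral_finsetSum _ fun k _ => integrable_inner_add_smul_sq_stdGaussian _ _ _,
    Finset.mul_sum, ← Finset.sum_add_distrib]
  simp_rw [integral_inner_add_smul_sq_stdGaussian]

theorem integrable_sq_sum_inner_add_smul_sq_stdGaussian {ι : Type*} [Fintype ι] (b : ι → E)
    (v : E) (c : ℝ) :
    Integrable (fun x : E => (∑ k, inner ℝ (b k) (v + c • x) ^ 2) ^ 2) (stdGaussian E) := by
  refine Integrable.mono' ((integrable_const (8 * (∑ k, inner ℝ (b k) v ^ 2) ^ 2)).add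
    ((integrable_sq_sum_inner_sq_stdGaussian b).const_mul (8 * c ^ 4))) (by fun_prop)
    (.of_forall fun x => ?_)
  rw [Real.norm_of_nonneg (by positivity)]
  exact sq_sum_inner_add_smul_sq_le b v x c

theorem integral_sq_sum_inner_add_smul_sq_stdGaussian_le {ι : Type*} [Fintype ι] (b : ι → E)
    (v : E) (c : ℝ) :
    ∫ x : E, (∑ k, inner ℝ (b k) (v + c • x) ^ 2) ^ 2 ∂(stdGaussian E)
      ≤ 8 * (∑ k, inner ℝ (b k) v ^ 2) ^ 2 + 32 * c ^ 4 * (∑ k, ‖b k‖ ^ 2) ^ 2 := by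
  have hi := (integrable_sq_sum_inner_sq_stdGaussian b).const_mul (8 * c ^ 4)
  refine (integral_mono (integrable_sq_sum_inner_add_smul_sq_stdGaussian b v c)
    ((integrable_const _).add hi) fun x => sq_sum_inner_add_smul_sq_le b v x c).trans ?_
  simp only [Pi.add_apply]
  rw [integral_add (integrable_const _) hi]
  rw [integral_const_mul (8 * c ^ 4) (fun x : E => (∑ k, inner ℝ (b k) x ^ 2) ^ 2)]
  have := mul_le_mul_of_nonneg_left (integral_sum_inner_sq_sq_stdGaussian_le b)
    (show 0 ≤ 8 * c ^ 4 by positivity)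
  simp only [integral_const, probReal_univ, smul_eq_mul, one_mul]
  linarith

/-- The Gaussian variational bound for a difference of quadratic forms. -/
theorem ofReal_exp_quadratic_le_lintegral {κ ι : Type*} [Fintype κ] [Fintype ι] (y : κ → E)
    (b : ι → E) {l m L β : ℝ} (hL : 0 ≤ L) (hβ : 0 < β) (v : E) :
    ENNReal.ofReal (Real.exp (-l * (∑ k, inner ℝ (y k) v ^ 2 + (∑ k, ‖y k‖ ^ 2) / β)
        + m * (∑ k, inner ℝ (b k) v ^ 2 + (∑ k, ‖b k‖ ^ 2) / β)
        - L * (8 * (∑ k, inner ℝ (b k) v ^ 2) ^ 2 + 32 * ((∑ k, ‖b k‖ ^ 2) / β) ^ 2)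
        - β * ‖v‖ ^ 2 / 2))
      ≤ ∫⁻ x : E, ENNReal.ofReal (Real.exp (-l * ∑ k, inner ℝ (y k) ((√β)⁻¹ • x) ^ 2
          + m * ∑ k, inner ℝ (b k) ((√β)⁻¹ • x) ^ 2
          - L * (∑ k, inner ℝ (b k) ((√β)⁻¹ • x) ^ 2) ^ 2)) ∂(stdGaussian E) := by
  have hs : 0 < √β := Real.sqrt_pos.2 hβ
  -- The prior is `N(0, β⁻¹ I)` and the posterior `N(v, β⁻¹ I)`. Translating the standard Gaussian
  -- by `√β v` costs `β ‖v‖² / 2`, and the posterior variance produces the terms divided by `β`.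
  set c := (√β)⁻¹ with hc
  have hc2 : c ^ 2 = β⁻¹ := by rw [hc, inv_pow, Real.sq_sqrt hβ.le]
  have hc4 : c ^ 4 = β⁻¹ ^ 2 := by rw [← hc2]; ring
  set h : E → ℝ := fun x => -l * ∑ k, inner ℝ (y k) (c • x) ^ 2
          + m * ∑ k, inner ℝ (b k) (c • x) ^ 2
          - L * (∑ k, inner ℝ (b k) (c • x) ^ 2) ^ 2 with hh
  have e : ∀ x, h (√β • v + x) = -l * ∑ k, inner ℝ (y k) (v + c • x) ^ 2
          + m * ∑ k, inner ℝ (b k) (v + c • x) ^ 2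
          - L * (∑ k, inner ℝ (b k) (v + c • x) ^ 2) ^ 2 := by
    intro x
    simp only [hh, smul_add, smul_smul, hc, inv_mul_cancel₀ hs.ne', one_smul]
  have i1 : Integrable (fun x => -l * ∑ k, inner ℝ (y k) (v + c • x) ^ 2) (stdGaussian E) :=
    (integrable_finsetSum _ fun k _ => integrable_inner_add_smul_sq_stdGaussian _ _ _).const_mul _
  have i2 : Integrable (fun x => m * ∑ k, inner ℝ (b k) (v + c • x) ^ 2) (stdGaussian E) :=
    (integrable_finsetSum _ fun k _ => integrable_inner_add_smul_sq_stdGaussian _ _ _).const_mul _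
  have i3 : Integrable (fun x => L * (∑ k, inner ℝ (b k) (v + c • x) ^ 2) ^ 2) (stdGaussian E) :=
    (integrable_sq_sum_inner_add_smul_sq_stdGaussian b v c).const_mul _
  have i12 : Integrable (fun x => -l * ∑ k, inner ℝ (y k) (v + c • x) ^ 2
      + m * ∑ k, inner ℝ (b k) (v + c • x) ^ 2) (stdGaussian E) := i1.add i2
  have hint : Integrable (fun x => h (√β • v + x)) (stdGaussian E) := by
    simp_rw [e]
    exact i12.sub i3
  refine le_trans (ENNReal.ofReal_le_ofReal (Real.exp_le_exp.2 ?_))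
    (ofReal_exp_integral_add_le (h := h) (by fun_prop) (√β • v) hint)
  simp_rw [e]
  rw [integral_sub i12 i3, integral_add i1 i2, integral_const_mul, integral_const_mul,
    integral_const_mul, integral_sum_inner_add_smul_sq_stdGaussian,
    integral_sum_inner_add_smul_sq_stdGaussian, norm_smul, mul_pow, Real.norm_of_nonneg hs.le,
    Real.sq_sqrt hβ.le, hc2]
  have := mul_le_mul_of_nonneg_left (integral_sq_sum_inner_add_smul_sq_stdGaussian_le b v c) hL
  rw [hc4] at this
  simp only [div_eq_mul_inv] at *
  linarith

end Variational

variable {𝒳 : Type*} [MeasurableSpace 𝒳] {p : Measure 𝒳} [IsProbabilityMeasure p]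

theorem lintegral_pi_prod_eq_pow {n : ℕ} {g : 𝒳 → ENNReal} (hg : Measurable g) :
    ∫⁻ w : Fin n → 𝒳, ∏ i, g (w i) ∂(Measure.pi fun _ => p) = (∫⁻ x, g x ∂p) ^ n := by
  rw [lintegral_prod_eq_prod_lintegral_of_indepFun Finset.univ (fun i (w : Fin n → 𝒳) => g (w i))
    (iIndepFun_pi fun i => hg.aemeasurable) (fun i => by fun_prop)]
  have : ∀ i : Fin n, ∫⁻ w : Fin n → 𝒳, g (w i) ∂(Measure.pi fun _ => p) = ∫⁻ x, g x ∂p :=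
    fun i => (measurePreserving_eval (fun _ : Fin n => p) i).lintegral_comp hg
  simp [this]

theorem measure_le_of_lintegral_le_one {Ω : Type*} [MeasurableSpace Ω] {P : Measure Ω}
    {F : Ω → ENNReal} (hF : Measurable F) (h : ∫⁻ w, F w ∂P ≤ 1) {η : ℝ} (hη : 0 < η) :
    P {w | ENNReal.ofReal (Real.exp (Real.log (1 / η))) ≤ F w} ≤ ENNReal.ofReal η := by
  have h1 := (mul_meas_ge_le_lintegral (μ := P) hF
    (ENNReal.ofReal (Real.exp (Real.log (1 / η))))).trans h
  rw [Real.exp_log (by positivity)] at h1 ⊢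
  calc _ = ENNReal.ofReal η * (ENNReal.ofReal (1 / η) * P {w | ENNReal.ofReal (1 / η) ≤ F w}) := by
        rw [← mul_assoc, ← ENNReal.ofReal_mul hη.le, mul_one_div_cancel hη.ne']
        simp
    _ ≤ ENNReal.ofReal η * 1 := by gcongr
    _ = _ := mul_one _

/-- A dimension-free PAC-Bayesian lower bound for the empirical quadratic form of i.i.d. vectors,
uniform in the direction. -/
theorem measure_pi_exists_quadratic_le {E : Type*} [NormedAddCommGroup E] [InnerProductSpace ℝ E]
    [FiniteDimensional ℝ E] [MeasurableSpace E] [BorelSpace E] {ι : Type*} [Fintype ι]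
    {Y : 𝒳 → E} (hY : Measurable Y) (b : ι → E) {l L β η : ℝ} (hL : 0 ≤ L) (hβ : 0 < β)
    (hη : 0 < η) (n : ℕ)
    (H : ∀ θ : E, ∫⁻ x, ENNReal.ofReal (Real.exp (-l * inner ℝ (Y x) θ ^ 2)) ∂p
      ≤ ENNReal.ofReal (Real.exp (-l * ∑ k, inner ℝ (b k) θ ^ 2
        + L * (∑ k, inner ℝ (b k) θ ^ 2) ^ 2))) :
    (Measure.pi fun _ : Fin n => p) {w | ∃ v : E, Real.log (1 / η) ≤
      -l * (∑ i, inner ℝ (Y (w i)) v ^ 2 + (∑ i, ‖Y (w i)‖ ^ 2) / β)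
        + n * l * (∑ k, inner ℝ (b k) v ^ 2 + (∑ k, ‖b k‖ ^ 2) / β)
        - n * L * (8 * (∑ k, inner ℝ (b k) v ^ 2) ^ 2 + 32 * ((∑ k, ‖b k‖ ^ 2) / β) ^ 2)
        - β * ‖v‖ ^ 2 / 2} ≤ ENNReal.ofReal η := by
  -- The likelihood-type factor for direction `θ`, normalised through `H` so that its mean over the
  -- sample is at most 1.
  set G : (Fin n → 𝒳) → E → ENNReal := fun w θ =>
    ENNReal.ofReal (Real.exp (-l * ∑ i, inner ℝ (Y (w i)) θ ^ 2
          + n * l * ∑ k, inner ℝ (b k) θ ^ 2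
          - n * L * (∑ k, inner ℝ (b k) θ ^ 2) ^ 2)) with hG
  have hG1 : ∀ θ, ∫⁻ w, G w θ ∂(Measure.pi fun _ : Fin n => p) ≤ 1 := by
    intro θ
    set s := ∑ k, inner ℝ (b k) θ ^ 2
    have e : ∀ w : Fin n → 𝒳, G w θ = ∏ i, (ENNReal.ofReal (Real.exp (l * s - L * s ^ 2)) *
        ENNReal.ofReal (Real.exp (-l * inner ℝ (Y (w i)) θ ^ 2))) := by
      intro w
      simp_rw [← ENNReal.ofReal_mul (Real.exp_nonneg _), ← Real.exp_add]
      rw [← ENNReal.ofReal_prod_of_nonneg fun _ _ => Real.exp_nonneg _, ← Real.exp_sum, hG,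
        Finset.sum_add_distrib, ← Finset.mul_sum]
      simp only [Finset.sum_const, Finset.card_univ, Fintype.card_fin, nsmul_eq_mul]
      congr 2
      ring
    simp_rw [e]
    rw [lintegral_pi_prod_eq_pow (g := fun x => ENNReal.ofReal (Real.exp (l * s - L * s ^ 2)) *
        ENNReal.ofReal (Real.exp (-l * inner ℝ (Y x) θ ^ 2))) (by fun_prop)]
    refine pow_le_one₀ (zero_le) ?_
    rw [lintegral_const_mul _ (by fun_prop)]
    calc _ ≤ ENNReal.ofReal (Real.exp (l * s - L * s ^ 2)) *
          ENNReal.ofReal (Real.exp (-l * s + L * s ^ 2)) := by gcongr; exact H θ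
      _ = 1 := by
        rw [← ENNReal.ofReal_mul (Real.exp_nonneg _), ← Real.exp_add]
        simp
  have hGm : Measurable (Function.uncurry fun (w : Fin n → 𝒳) (x : E) => G w ((√β)⁻¹ • x)) := by
    simp only [hG, Function.uncurry_def]
    fun_prop
  have hint : ∫⁻ w, ∫⁻ x, G w ((√β)⁻¹ • x) ∂(stdGaussian E) ∂(Measure.pi fun _ : Fin n => p)
      ≤ 1 := by
    rw [lintegral_lintegral_swap hGm.aemeasurable]
    calc _ ≤ ∫⁻ _, 1 ∂(stdGaussian E) := lintegral_mono fun x => hG1 _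
      _ = 1 := by simp
  -- Markov is applied to the prior average, which does not involve `v`; hence uniformity over all
  -- `v` without a net or union bound.
  refine le_trans (measure_mono ?_) (measure_le_of_lintegral_le_one hGm.lintegral_prod_right hint hη)
  rintro w ⟨v, hv⟩
  refine le_trans (ENNReal.ofReal_le_ofReal (Real.exp_le_exp.2 hv)) ?_
  exact ofReal_exp_quadratic_le_lintegral (fun i => Y (w i)) b (by positivity) hβ v

/-- A Chernoff bound for the upper tail of a sum of i.i.d. variables. -/
theorem measure_pi_le_sum_le {U : 𝒳 → ℝ} (hU : Measurable U) {a c η : ℝ} (hη : 0 < η) (n : ℕ)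
    (H : ∫⁻ x, ENNReal.ofReal (Real.exp (a * U x)) ∂p ≤ ENNReal.ofReal (Real.exp c)) :
    (Measure.pi fun _ : Fin n => p) {w | Real.log (1 / η) ≤ a * ∑ i, U (w i) - n * c}
      ≤ ENNReal.ofReal η := by
  have e : ∀ w : Fin n → 𝒳, ENNReal.ofReal (Real.exp (a * ∑ i, U (w i) - n * c))
      = ∏ i, (ENNReal.ofReal (Real.exp (-c)) * ENNReal.ofReal (Real.exp (a * U (w i)))) := by
    intro w
    simp_rw [← ENNReal.ofReal_mul (Real.exp_nonneg _), ← Real.exp_add]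
    rw [← ENNReal.ofReal_prod_of_nonneg fun _ _ => Real.exp_nonneg _, ← Real.exp_sum,
      Finset.sum_add_distrib, ← Finset.mul_sum]
    simp only [Finset.sum_const, Finset.card_univ, Fintype.card_fin, nsmul_eq_mul]
    congr 2
    ring
  have hint : ∫⁻ w, ENNReal.ofReal (Real.exp (a * ∑ i, U (w i) - n * c))
      ∂(Measure.pi fun _ : Fin n => p) ≤ 1 := by
    simp_rw [e]
    rw [lintegral_pi_prod_eq_pow (g := fun x => ENNReal.ofReal (Real.exp (-c)) *
      ENNReal.ofReal (Real.exp (a * U x))) (by fun_prop)]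
    refine pow_le_one₀ (zero_le) ?_
    rw [lintegral_const_mul _ (by fun_prop)]
    calc _ ≤ ENNReal.ofReal (Real.exp (-c)) * ENNReal.ofReal (Real.exp c) := by gcongr
      _ = 1 := by
        rw [← ENNReal.ofReal_mul (Real.exp_nonneg _), ← Real.exp_add]
        simp
  refine le_trans (measure_mono ?_) (measure_le_of_lintegral_le_one (by fun_prop) hint hη)
  intro w hw
  exact ENNReal.ofReal_le_ofReal (Real.exp_le_exp.2 hw)

end ProbabilityTheory

/-! ### Spectral norm, covariance matrix and sub-Gaussian embeddings -/

theorem specNorm_nonneg {d : ℕ} (A : Matrix (Fin d) (Fin d) ℝ) : 0 ≤ specNorm A := norm_nonneg _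

theorem dotProduct_mulVec_le_specNorm {d : ℕ} (A : Matrix (Fin d) (Fin d) ℝ)
    (v : EuclideanSpace ℝ (Fin d)) : v.ofLp ⬝ᵥ A *ᵥ v.ofLp ≤ specNorm A * ‖v‖ ^ 2 := by
  have e : v.ofLp ⬝ᵥ A *ᵥ v.ofLp = inner ℝ v (Matrix.toEuclideanCLM (n := Fin d) (𝕜 := ℝ) A v) := by
    rw [EuclideanSpace.inner_eq_star_dotProduct, Matrix.ofLp_toEuclideanCLM, dotProduct_comm]
    simp
  rw [e]
  calc _ ≤ ‖v‖ * ‖Matrix.toEuclideanCLM (n := Fin d) (𝕜 := ℝ) A v‖ := real_inner_le_norm _ _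
    _ ≤ ‖v‖ * (specNorm A * ‖v‖) := by gcongr; exact ContinuousLinearMap.le_opNorm _ _
    _ = _ := by ring

theorem Matrix.PosSemidef.exists_sum_inner_sq {d : ℕ} {A : Matrix (Fin d) (Fin d) ℝ}
    (hA : A.PosSemidef) : ∃ b : Fin d → EuclideanSpace ℝ (Fin d),
      (∀ v, ∑ k, inner ℝ (b k) v ^ 2 = v.ofLp ⬝ᵥ A *ᵥ v.ofLp) ∧ ∑ k, ‖b k‖ ^ 2 = A.trace := by
  obtain ⟨R, hR, rfl⟩ := hA.exists_sqrt
  refine ⟨fun k => WithLp.toLp 2 (R k), fun v => ?_, ?_⟩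
  · have e : v.ofLp ⬝ᵥ (R * R) *ᵥ v.ofLp = (R *ᵥ v.ofLp) ⬝ᵥ (R *ᵥ v.ofLp) := by
      rw [← mulVec_mulVec, dotProduct_mulVec, ← mulVec_transpose, hR.isSymm]
    rw [e, dotProduct]
    refine Finset.sum_congr rfl fun k _ => ?_
    rw [← sq, EuclideanSpace.inner_eq_star_dotProduct, dotProduct_comm]
    simp [mulVec]
  · rw [trace]
    refine Finset.sum_congr rfl fun k _ => ?_
    rw [EuclideanSpace.norm_sq_eq, diag_apply, mul_apply]
    refine Finset.sum_congr rfl fun j _ => ?_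
    have : R j k = R k j := congrFun (congrFun hR.isSymm k) j
    simp [this, sq]

section Moments

variable {𝒳 : Type*} [MeasurableSpace 𝒳] {d : ℕ} {f : 𝒳 → EuclideanSpace ℝ (Fin d)}
  {p : Measure 𝒳} [IsProbabilityMeasure p]

theorem embMean_apply (hf : MemLp f 2 p) (i : Fin d) : embMean f p i = ∫ x, f x i ∂p :=
  ((EuclideanSpace.proj (𝕜 := ℝ) i).integral_comp_comm (hf.integrable one_le_two)).symm

theorem memLp_sub_embMean (hf : MemLp f 2 p) : MemLp (fun x => f x - embMean f p) 2 p :=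
  hf.sub (memLp_const _)

theorem memLp_sub_embMean_apply (hf : MemLp f 2 p) (i : Fin d) :
    MemLp (fun x => (f x - embMean f p) i) 2 p :=
  (EuclideanSpace.proj (𝕜 := ℝ) i).comp_memLp' (memLp_sub_embMean hf)

theorem embCov_apply (hf : MemLp f 2 p) (i j : Fin d) :
    embCov f p i j = ∫ x, (f x - embMean f p) i * (f x - embMean f p) j ∂p := by
  simp [embCov, covariance, embMean_apply hf]

theorem dotProduct_embCov_mulVec (hf : MemLp f 2 p) (v : EuclideanSpace ℝ (Fin d)) :
    v.ofLp ⬝ᵥ embCov f p *ᵥ v.ofLp = ∫ x, inner ℝ (f x - embMean f p) v ^ 2 ∂p := by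
  have e : ∀ x, inner ℝ (f x - embMean f p) v ^ 2
      = ∑ i, ∑ j, v i * v j * ((f x - embMean f p) i * (f x - embMean f p) j) := by
    intro x
    rw [PiLp.inner_apply, sq, Finset.sum_mul_sum]
    refine Finset.sum_congr rfl fun i _ => Finset.sum_congr rfl fun j _ => ?_
    simp only [RCLike.inner_apply, conj_trivial]
    ring
  have hi : ∀ i j, Integrable (fun x => v i * v j *
      ((f x - embMean f p) i * (f x - embMean f p) j)) p := fun i j =>
    ((memLp_sub_embMean_apply hf i).integrable_mul (memLp_sub_embMean_apply hf j)).const_mul _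
  simp_rw [e]
  rw [integral_finsetSum _ fun i _ => integrable_finsetSum _ fun j _ => hi i j]
  simp_rw [integral_finsetSum _ fun j _ => hi _ j, integral_const_mul, ← embCov_apply hf]
  simp only [dotProduct, mulVec, Finset.mul_sum]
  refine Finset.sum_congr rfl fun i _ => Finset.sum_congr rfl fun j _ => by ring

theorem posSemidef_embCov (hf : MemLp f 2 p) : (embCov f p).PosSemidef := by
  refine .of_dotProduct_mulVec_nonneg ?_ fun v => ?_
  · ext i j
    simp [embCov, covariance_comm]
  · have := dotProduct_embCov_mulVec hf (WithLp.toLp 2 v)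
    simp only [star_trivial]
    rw [this]
    exact integral_nonneg fun x => sq_nonneg _

theorem trace_embCov (hf : MemLp f 2 p) :
    (embCov f p).trace = ∫ x, ‖f x - embMean f p‖ ^ 2 ∂p := by
  simp_rw [EuclideanSpace.norm_sq_eq, Real.norm_eq_abs, sq_abs]
  rw [integral_finsetSum _ fun i _ => (memLp_sub_embMean_apply hf i).integrable_sq, trace]
  refine Finset.sum_congr rfl fun i _ => ?_
  rw [diag_apply, embCov_apply hf]
  simp_rw [sq]

/-- The strict inequality `κ² < K` avoids having to show that the infimum defining the norm is
attained. If the variance vanishes, division by zero makes the exponent 0. -/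
theorem IsSubGaussianConst.lintegral_exp_le {κ K : ℝ} (hκ : IsSubGaussianConst f p κ)
    (hK : κ ^ 2 < K) (v : EuclideanSpace ℝ (Fin d)) :
    ∫⁻ x, ENNReal.ofReal (Real.exp (inner ℝ (f x - embMean f p) v ^ 2
      / (K * (v.ofLp ⬝ᵥ embCov f p *ᵥ v.ofLp)))) ∂p ≤ 2 := by
  set s := v.ofLp ⬝ᵥ embCov f p *ᵥ v.ofLp
  rcases le_or_gt s 0 with hs | hs
  · calc _ ≤ ∫⁻ _, 1 ∂p := by
          refine lintegral_mono fun x => ?_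
          rw [ENNReal.ofReal_le_one, Real.exp_le_one_iff]
          exact div_nonpos_of_nonneg_of_nonpos (sq_nonneg _)
            (mul_nonpos_of_nonneg_of_nonpos ((sq_nonneg κ).trans hK.le) hs)
      _ ≤ 2 := by simp
  · have hK0 : 0 < K := (sq_nonneg κ).trans_lt hK
    have hlt : κ * √s < √(K * s) := by
      refine Real.lt_sqrt_of_sq_lt ?_
      rw [mul_pow, Real.sq_sqrt hs.le]
      gcongr
    have h := lintegral_exp_sq_div_sq_le_of_psi2Norm_lt ((hκ v).trans_lt
      ((ENNReal.ofReal_lt_ofReal_iff (by positivity)).2 hlt))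
    rw [Real.sq_sqrt (by positivity)] at h
    simpa only [real_inner_comm v] using h

/-- For `K > κ²`, the variable `Z² / (K s)` has mean `1 / K`, and the exponential moment bound
forces this mean to be at most 1. -/
theorem IsSubGaussianConst.one_le_sq {κ : ℝ} (hfm : Measurable f) (hf : MemLp f 2 p)
    (hκ : IsSubGaussianConst f p κ) {v : EuclideanSpace ℝ (Fin d)}
    (hv : 0 < v.ofLp ⬝ᵥ embCov f p *ᵥ v.ofLp) : 1 ≤ κ ^ 2 := by
  by_contra hlt
  rw [not_le] at hlt
  have hK : κ ^ 2 < (κ ^ 2 + 1) / 2 := by linarith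
  have hK1 : (κ ^ 2 + 1) / 2 < 1 := by linarith
  have hK0 : 0 < (κ ^ 2 + 1) / 2 := by positivity
  have h := integral_le_one_of_lintegral_exp_le (by fun_prop) (fun x => by positivity)
    (hκ.lintegral_exp_le hK v)
  rw [integral_div, ← dotProduct_embCov_mulVec hf, div_le_one (by positivity)] at h
  nlinarith

/-- `‖f - μ‖² / (K T)` is the convex combination, with weights `sᵢ / T`, of the coordinate variables
`(f - μ)ᵢ² / (K sᵢ)`, so Jensen applies. Coordinates of zero variance vanish almost everywhere. -/
theorem IsSubGaussianConst.lintegral_exp_norm_sq_le {κ K : ℝ} (hfm : Measurable f)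
    (hf : MemLp f 2 p) (hκ : IsSubGaussianConst f p κ) (hK : κ ^ 2 < K)
    (hT : 0 < (embCov f p).trace) :
    ∫⁻ x, ENNReal.ofReal (Real.exp (‖f x - embMean f p‖ ^ 2 / (K * (embCov f p).trace))) ∂p
      ≤ 2 := by
  have hK0 : 0 < K := (sq_nonneg κ).trans_lt hK
  set T := (embCov f p).trace with hTdef
  set s : Fin d → ℝ := fun i => embCov f p i i with hs
  have hs0 : ∀ i, 0 ≤ s i := fun i => by
    rw [hs]; simp only [embCov_apply hf]; exact integral_nonneg fun x => mul_self_nonneg _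
  have hsum : ∑ i, s i / T = 1 := by
    rw [← Finset.sum_div, div_eq_one_iff_eq hT.ne', hTdef]; rfl
  have h2 : ∀ i, ∫⁻ x, ENNReal.ofReal (Real.exp ((f x - embMean f p) i ^ 2 / (K * s i))) ∂p
      ≤ 2 := by
    intro i
    have := hκ.lintegral_exp_le hK (EuclideanSpace.single i 1)
    simpa [EuclideanSpace.inner_single_right] using this
  have h0 : ∀ᵐ x ∂p, ∀ i, s i = 0 → (f x - embMean f p) i = 0 := by
    rw [ae_all_iff]
    intro i
    by_cases hi : s i = 0
    · have e : ∫ x, (f x - embMean f p) i ^ 2 ∂p = 0 := by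
        rw [← hi, hs]; simp only [embCov_apply hf, sq]
      rw [integral_eq_zero_iff_of_nonneg (fun x => sq_nonneg _)
        (memLp_sub_embMean_apply hf i).integrable_sq] at e
      filter_upwards [e] with x hx _
      simpa using hx
    · exact .of_forall fun x h => absurd h hi
  calc _ ≤ ∫⁻ x, ∑ i, ENNReal.ofReal (s i / T) *
        ENNReal.ofReal (Real.exp ((f x - embMean f p) i ^ 2 / (K * s i))) ∂p := by
        refine lintegral_mono_ae ?_
        filter_upwards [h0] with x hx
        simp_rw [← ENNReal.ofReal_mul (div_nonneg (hs0 _) hT.le)]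
        rw [← ENNReal.ofReal_sum_of_nonneg fun i _ => mul_nonneg (div_nonneg (hs0 _) hT.le)
          (Real.exp_nonneg _)]
        refine ENNReal.ofReal_le_ofReal ?_
        have hc := convexOn_exp.map_sum_le (t := Finset.univ) (w := fun i => s i / T)
          (p := fun i => (f x - embMean f p) i ^ 2 / (K * s i))
          (fun i _ => div_nonneg (hs0 _) hT.le) hsum (fun i _ => Set.mem_univ _)
        simp only [smul_eq_mul] at hc
        refine le_of_eq_of_le ?_ hc
        congr 1
        simp_rw [EuclideanSpace.norm_sq_eq, Real.norm_eq_abs, sq_abs]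
        rw [Finset.sum_div]
        refine Finset.sum_congr rfl fun i _ => ?_
        rcases eq_or_ne (s i) 0 with hi | hi
        · simp only [hx i hi, hi]; simp
        · field_simp
    _ = ∑ i, ENNReal.ofReal (s i / T) *
        ∫⁻ x, ENNReal.ofReal (Real.exp ((f x - embMean f p) i ^ 2 / (K * s i))) ∂p := by
        rw [lintegral_finsetSum _ fun i _ => by fun_prop]
        refine Finset.sum_congr rfl fun i _ => ?_
        rw [lintegral_const_mul _ (by fun_prop)]
    _ ≤ ∑ i, ENNReal.ofReal (s i / T) * 2 := by
        gcongr with i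
        exact h2 i
    _ = 2 := by
        rw [← Finset.sum_mul, ← ENNReal.ofReal_sum_of_nonneg fun i _ =>
          div_nonneg (hs0 _) hT.le, hsum]
        simp

end Moments

/-! ### Lower tail of the sample covariance -/

/-- The choice of parameters, isolated from probability: `N`, `T`, `r` are spectral norm, trace and
effective rank, `B` and `W` the empirical quadratic form and squared norms. Since `T / β = N / 8`
and `l K N = q / 2`, all errors are multiples of `q² n`. -/
theorem le_of_log_bounds {s B W N T r t q a K n A D l β : ℝ} (hn : 0 < n) (hN : 0 < N)
    (hr : 0 < r) (hT : T = r * N) (hK : 0 < K) (ht : 0 < t) (hq : 0 < q)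
    (hq2 : q ^ 2 * n = 4 * r + t) (ha : 0 < a) (ha2 : a ^ 2 * n = t) (hs0 : 0 ≤ s) (hsN : s ≤ N)
    (hl : l = q / (2 * K * N)) (hβ : β = 8 * r)
    (hA : A ≤ 2 * t) (hB : -l * (B + W / β) + n * l * (s + T / β)
      - n * (l * K) ^ 2 * (8 * s ^ 2 + 32 * (T / β) ^ 2) - β * 1 / 2 < A)
    (hD : D = W / (K * T)) (hW : a * D - n * (a * (1 / K) + a ^ 2) < A) :
    s - n⁻¹ * B ≤ 10 * K * N * q := by
  have hT0 : 0 < T := hT ▸ by positivity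
  have hl0 : 0 < l := hl ▸ by positivity
  have haq : a ≤ q := by
    refine (pow_le_pow_iff_left₀ ha.le hq.le two_ne_zero).1 ?_
    refine le_of_mul_le_mul_right ?_ hn
    linarith
  have hWle : W ≤ n * T + 3 * n * a * K * T := by
    have hWD : W = D * (K * T) := by rw [hD]; field_simp
    have h1 : a * D ≤ a * (n * (1 / K) + 3 * a * n) := by nlinarith
    have h2 := le_of_mul_le_mul_left h1 ha
    have h3 := mul_le_mul_of_nonneg_right h2 (show 0 ≤ K * T by positivity)
    rw [hWD]
    refine h3.trans_eq ?_
    field_simp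
  have hTβ : T / β = N / 8 := by rw [hT, hβ]; field_simp
  have hWβ : W / β ≤ n * (N / 8) + 3 * n * a * K * (N / 8) := by
    have h := div_le_div_of_nonneg_right hWle (show 0 ≤ β by rw [hβ]; positivity)
    refine h.trans_eq ?_
    rw [← hTβ]; ring
  have hs2 : s ^ 2 ≤ N ^ 2 := pow_le_pow_left₀ hs0 hsN 2
  rw [hTβ, hβ] at hB
  have hlK : l * K * N = q / 2 := by rw [hl]; field_simp
  have h4 : n * (l * K) ^ 2 * (8 * s ^ 2 + 32 * (N / 8) ^ 2) ≤ 17 / 8 * (q ^ 2 * n) := by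
    calc _ ≤ n * (l * K) ^ 2 * (8 * N ^ 2 + 32 * (N / 8) ^ 2) := by gcongr
      _ = n * (l * K * N) ^ 2 * (17 / 2) := by ring
      _ = _ := by rw [hlK]; ring
  have h5 := mul_le_mul_of_nonneg_left hWβ hl0.le
  rw [hβ] at h5
  -- In units of `q² n = 4r + t`: at most 2 from `A + β / 2`, `3/16` from the smoothing terms and
  -- `17/8` from the second-order terms, in total below 5.
  have h6 : l * (n * s - B) ≤ l * (n * (10 * K * N * q)) := by
    have e1 : l * (3 * n * a * K * (N / 8)) = 3 / 16 * n * a * q := by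
      calc _ = l * K * N * (3 / 8 * n * a) := by ring
        _ = _ := by rw [hlK]; ring
    have e2 : l * (n * (10 * K * N * q)) = 5 * (q ^ 2 * n) := by
      calc _ = l * K * N * (10 * n * q) := by ring
        _ = _ := by rw [hlK]; ring
    have e3 : n * a * q ≤ q ^ 2 * n := by nlinarith [mul_pos hn hq]
    rw [e2]
    linarith
  have h7 := le_of_mul_le_mul_left h6 hl0
  rw [← mul_le_mul_iff_right₀ hn, mul_sub, mul_inv_cancel_left₀ hn.ne']
  exact h7

section

variable {𝒳 : Type*} [MeasurableSpace 𝒳] {d : ℕ} {f : 𝒳 → EuclideanSpace ℝ (Fin d)}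
  {p : Measure 𝒳} [IsProbabilityMeasure p]

/-- A dimension-free lower tail bound for the sample covariance matrix. -/
theorem measure_pi_not_embCov_sub_le {κ δ : ℝ} (hfm : Measurable f) (hf : MemLp f 2 p)
    (hκ : IsSubGaussianConst f p κ) (hδ0 : 0 < δ) (hδ1 : δ < 1) {n : ℕ} (hn : 0 < n) :
    (Measure.pi fun _ : Fin n => p) {w | ¬ ∀ v : EuclideanSpace ℝ (Fin d),
      v.ofLp ⬝ᵥ embCov f p *ᵥ v.ofLp
          - (n : ℝ)⁻¹ * ∑ i, inner ℝ (f (w i) - embMean f p) v ^ 2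
        ≤ 20 * κ ^ 2 * specNorm (embCov f p)
          * √((4 * effRank (embCov f p) + Real.log (3 / δ)) / n) * ‖v‖ ^ 2}
      ≤ ENNReal.ofReal (δ / 3) := by
  set S := embCov f p with hSdef
  set N := specNorm S with hNdef
  set q := √((4 * effRank S + Real.log (3 / δ)) / n) with hq
  have hn' : (0 : ℝ) < n := by exact_mod_cast hn
  have hq0 : 0 ≤ q := Real.sqrt_nonneg _
  have hN0 : 0 ≤ N := specNorm_nonneg S
  have hsum0 : ∀ (w : Fin n → 𝒳) (v : EuclideanSpace ℝ (Fin d)),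
      0 ≤ (n : ℝ)⁻¹ * ∑ i, inner ℝ (f (w i) - embMean f p) v ^ 2 := fun w v => by positivity
  by_cases hdeg : ∀ v : EuclideanSpace ℝ (Fin d), v.ofLp ⬝ᵥ S *ᵥ v.ofLp ≤ 0
  · refine (measure_mono (t := ∅) fun w hw => absurd (fun v => ?_) hw).trans (by simp)
    have : 0 ≤ 20 * κ ^ 2 * N * q * ‖v‖ ^ 2 := by positivity
    linarith [hdeg v, hsum0 w v]
  push Not at hdeg
  obtain ⟨v₀, hv₀⟩ := hdeg
  have hκ1 := hκ.one_le_sq hfm hf hv₀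
  have hSN := dotProduct_mulVec_le_specNorm S
  have hN : 0 < N := by
    by_contra h
    have : N = 0 := le_antisymm (not_lt.1 h) hN0
    have h2 := hSN v₀
    rw [← hNdef, this, zero_mul] at h2
    linarith
  obtain ⟨b, hb, hbT⟩ := (posSemidef_embCov hf).exists_sum_inner_sq
  rw [← hSdef] at hb hbT
  have hT : 0 < S.trace := by
    rw [← hbT]
    refine (Finset.sum_nonneg fun k _ => sq_nonneg _).lt_of_ne fun h => ?_
    rw [eq_comm, Finset.sum_eq_zero_iff_of_nonneg fun k _ => sq_nonneg _] at h
    have h0 : ∀ k, b k = 0 := fun k => by simpa using h k (Finset.mem_univ _)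
    have := hb v₀
    simp [h0] at this
    linarith
  set t := Real.log (3 / δ) with htdef
  set r := effRank S with hrdef
  have hr : 0 < r := div_pos hT hN
  have hTr : S.trace = r * N := by rw [hrdef, effRank, div_mul_cancel₀ _ hN.ne']
  have hlog2 : Real.log 2 ≤ t := Real.log_le_log (by norm_num) (by
    rw [le_div_iff₀ hδ0]; linarith)
  have hlog2' : 0 < Real.log 2 := Real.log_pos (by norm_num)
  have ht : 0 < t := by linarith
  have hq2 : q ^ 2 * n = 4 * r + t := by
    rw [hq, Real.sq_sqrt (by positivity), div_mul_cancel₀ _ hn'.ne']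
  have hqpos : 0 < q := Real.sqrt_pos.2 (by positivity)
  have hKpos : 0 < 2 * κ ^ 2 := by linarith
  -- For small `n` one has `q ≥ 1`, and the bound is trivial because `κ² ≥ 1`. Otherwise `a ≤ 1`, as
  -- Bernstein's bound requires.
  rcases le_or_gt (n : ℝ) (4 * r + t) with hsmall | hlarge
  · refine (measure_mono (t := ∅) fun w hw => absurd (fun v => ?_) hw).trans (by simp)
    have hq1 : 1 ≤ q := by
      rw [hq, Real.one_le_sqrt, one_le_div hn']
      exact hsmall
    have h1 : N * ‖v‖ ^ 2 ≤ 20 * κ ^ 2 * N * q * ‖v‖ ^ 2 := by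
      have h2 : 1 ≤ 20 * κ ^ 2 * q := by nlinarith
      calc N * ‖v‖ ^ 2 = 1 * (N * ‖v‖ ^ 2) := (one_mul _).symm
        _ ≤ 20 * κ ^ 2 * q * (N * ‖v‖ ^ 2) := by gcongr
        _ = _ := by ring
    linarith [hSN v, hsum0 w v]
  set K := 2 * κ ^ 2 with hK
  have hκK : κ ^ 2 < K := by linarith
  set l := q / (2 * K * N) with hl
  have hl0 : 0 < l := by positivity
  set a := √(t / n) with ha
  have ha0 : 0 < a := Real.sqrt_pos.2 (by positivity)
  have ha2 : a ^ 2 * n = t := by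
    rw [ha, Real.sq_sqrt (by positivity), div_mul_cancel₀ _ hn'.ne']
  have ha1 : a ≤ 1 := by
    rw [ha, Real.sqrt_le_one, div_le_one hn']
    linarith
  have hη : 0 < δ / 6 := by positivity
  -- The budget `δ / 3` is halved between the quadratic form and the norms; `3 / δ ≥ 2` absorbs the
  -- extra `log 2`.
  have hA : Real.log (1 / (δ / 6)) ≤ 2 * t := by
    have : 1 / (δ / 6) = 2 * (3 / δ) := by field_simp; norm_num
    rw [this, Real.log_mul (by norm_num) (by positivity)]
    linarith
  have hYm : Measurable fun x => f x - embMean f p := by fun_prop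
  have hquad := measure_pi_exists_quadratic_le (p := p) hYm b (l := l) (L := (l * K) ^ 2)
    (β := 8 * r) (sq_nonneg _) (by positivity) hη n (fun θ => by
      rw [hb]
      exact lintegral_exp_neg_mul_sq_le (by fun_prop) hKpos hl0.le
        (dotProduct_embCov_mulVec hf θ).symm (hκ.lintegral_exp_le hκK θ))
  have hU := hκ.lintegral_exp_norm_sq_le hfm hf hκK hT
  have hUint : ∫ x, ‖f x - embMean f p‖ ^ 2 / (K * S.trace) ∂p = 1 / K := by
    rw [integral_div, ← trace_embCov hf, ← hSdef]
    field_simp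
  have htr := measure_pi_le_sum_le (p := p) (U := fun x => ‖f x - embMean f p‖ ^ 2 / (K * S.trace))
    (by fun_prop) hη n (lintegral_exp_mul_le (by fun_prop) (fun x => by positivity) hU ha1)
  rw [hUint] at htr
  refine le_trans (measure_mono ?_) ((measure_union_le _ _).trans (add_le_add hquad htr)
    |>.trans_eq ?_)
  · intro w hw
    by_contra hcon
    simp only [Set.mem_union, Set.mem_ofPred_eq, not_or, not_exists, not_le] at hcon
    obtain ⟨h1, h2⟩ := hcon
    refine hw fun v => ?_
    rcases eq_or_ne v 0 with rfl | hv
    · simp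
    have hvn : 0 < ‖v‖ := norm_pos_iff.2 hv
    have hu : ‖(‖v‖⁻¹ • v)‖ = 1 := by
      rw [norm_smul, norm_inv, norm_norm, inv_mul_cancel₀ hvn.ne']
    -- The PAC-Bayesian bound is not homogeneous in `v`, so it is used on unit vectors and rescaled.
    have key := h1 (‖v‖⁻¹ • v)
    rw [hb, hbT, hu, one_pow] at key
    have hs0 : 0 ≤ (‖v‖⁻¹ • v).ofLp ⬝ᵥ S *ᵥ (‖v‖⁻¹ • v).ofLp := by
      rw [← hb]; positivity
    have hsN : (‖v‖⁻¹ • v).ofLp ⬝ᵥ S *ᵥ (‖v‖⁻¹ • v).ofLp ≤ N := by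
      have := hSN (‖v‖⁻¹ • v)
      rwa [hu, one_pow, mul_one] at this
    have hfin := le_of_log_bounds hn' hN hr hTr hKpos ht hqpos hq2 ha0 ha2 hs0 hsN hl rfl hA key
      (Finset.sum_div _ _ _).symm h2
    simp only [WithLp.ofLp_smul, mulVec_smul, dotProduct_smul, smul_dotProduct, smul_eq_mul,
      inner_smul_right, mul_pow] at hfin
    rw [← Finset.mul_sum] at hfin
    have hfin2 := mul_le_mul_of_nonneg_right hfin (sq_nonneg ‖v‖)
    refine le_of_eq_of_le ?_ (hfin2.trans_eq ?_)
    · field_simp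
    · rw [hK]; ring
  · rw [← ENNReal.ofReal_add hη.le hη.le]
    congr 1; ring

end

/-! ### Hoeffding bounds for the mean and the trace -/

section

variable {𝒳 : Type*} [MeasurableSpace 𝒳] {p : Measure 𝒳} [IsProbabilityMeasure p]

/-- Hoeffding's inequality for the mean of i.i.d. bounded variables. -/
theorem measure_pi_le_mean_sub_le {g : 𝒳 → ℝ} (hg : Measurable g) {a b η : ℝ} (hab : a < b)
    (h : ∀ᵐ x ∂p, g x ∈ Set.Icc a b) (hη : 0 < η) (hη1 : η ≤ 1) {n : ℕ} (hn : 0 < n) :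
    (Measure.pi fun _ : Fin n => p)
      {w | (b - a) * √(1 / (2 * n) * Real.log (1 / η)) ≤ (n : ℝ)⁻¹ * ∑ i, g (w i) - ∫ x, g x ∂p}
      ≤ ENNReal.ofReal η := by
  set P := Measure.pi fun _ : Fin n => p
  have hn' : (0 : ℝ) < n := by exact_mod_cast hn
  have hmp := measurePreserving_eval (fun _ : Fin n => p)
  have hint : ∀ i, ∫ w, g (w i) ∂P = ∫ x, g x ∂p := fun i => by
    rw [← (hmp i).map_eq, integral_map (hmp i).aemeasurable (by fun_prop)]
  have hsub : ∀ i, HasSubgaussianMGF (fun w : Fin n → 𝒳 => g (w i) - ∫ x, g x ∂p)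
      ((‖b - a‖₊ / 2) ^ 2) P := by
    intro i
    have := hasSubgaussianMGF_of_mem_Icc (μ := P) (X := fun w : Fin n → 𝒳 => g (w i)) (a := a)
      (b := b) (hg.comp (measurable_pi_apply i)).aemeasurable ((hmp i).quasiMeasurePreserving.ae h)
    rwa [hint] at this
  have hind : iIndepFun (fun i (w : Fin n → 𝒳) => g (w i) - ∫ x, g x ∂p) P :=
    iIndepFun_pi (X := fun _ x => g x - ∫ x, g x ∂p) fun i => by fun_prop
  have hlog : 0 ≤ Real.log (1 / η) := Real.log_nonneg (by rw [le_div_iff₀ hη]; linarith)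
  set e := (b - a) * √(1 / (2 * n) * Real.log (1 / η)) with he
  have he0 : 0 ≤ e := mul_nonneg (by linarith) (Real.sqrt_nonneg _)
  have key := HasSubgaussianMGF.measure_sum_ge_le_of_iIndepFun hind (s := Finset.univ)
    (fun i _ => hsub i) (ε := n * e) (by positivity)
  have hexp : Real.exp (-(n * e) ^ 2 / (2 * ((∑ _i : Fin n, (‖b - a‖₊ / 2) ^ 2 : NNReal) : ℝ)))
      = η := by
    have hba : 0 < b - a := by linarith
    have hne : b - a ≠ 0 := hba.ne'
    simp only [Finset.sum_const, Finset.card_univ, Fintype.card_fin, nsmul_eq_mul]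
    push_cast
    rw [Real.norm_of_nonneg hba.le]
    have e2 : e ^ 2 = (b - a) ^ 2 * (1 / (2 * n) * Real.log (1 / η)) := by
      rw [he, mul_pow, Real.sq_sqrt (by positivity)]
    have : -(n * e) ^ 2 / (2 * (n * ((b - a) / 2) ^ 2)) = Real.log η := by
      rw [mul_pow, e2, one_div η, Real.log_inv]
      field_simp
    rw [this, Real.exp_log hη]
  rw [hexp] at key
  refine le_trans (measure_mono fun w hw => ?_)
    ((ENNReal.le_ofReal_iff_toReal_le (measure_ne_top _ _) hη.le).2 key)
  simp only [Set.mem_ofPred_eq] at hw ⊢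
  rw [Finset.sum_sub_distrib]
  simp only [Finset.sum_const, Finset.card_univ, Fintype.card_fin, nsmul_eq_mul]
  have := mul_le_mul_of_nonneg_left hw hn'.le
  rwa [mul_sub, mul_inv_cancel_left₀ hn'.ne'] at this

variable {d : ℕ} {f : 𝒳 → EuclideanSpace ℝ (Fin d)}

theorem log_six_mul_div_nonneg (d : ℕ) {δ : ℝ} (hδ0 : 0 < δ) (hδ1 : δ < 1) :
    0 ≤ Real.log (6 * d / δ) := by
  rcases Nat.eq_zero_or_pos d with rfl | hd
  · simp
  · have : (1 : ℝ) ≤ d := by exact_mod_cast hd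
    exact Real.log_nonneg (by rw [le_div_iff₀ hδ0]; linarith)

theorem meanErr_sq {n : ℕ} {δ : ℝ} (hδ0 : 0 < δ) (hδ1 : δ < 1) (C : ℝ)
    {S : Matrix (Fin d) (Fin d) ℝ} (hS : S.PosSemidef) :
    meanErr n δ C S ^ 2 = 2 * d * C ^ 2 / n * Real.log (6 * d / δ) + S.trace / n := by
  have := log_six_mul_div_nonneg d hδ0 hδ1
  have := hS.trace_nonneg
  exact Real.sq_sqrt (by positivity)

theorem measure_pi_meanErr_lt_le {C δ : ℝ} (hfm : Measurable f) (hC : 0 < C)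
    (hf : ∀ᵐ x ∂p, ‖f x‖ ≤ C) (hδ0 : 0 < δ) (hδ1 : δ < 1) {n : ℕ} (hn : 0 < n) :
    (Measure.pi fun _ : Fin n => p) {w | ¬ ‖empMean (fun i => f (w i)) - embMean f p‖
      ≤ meanErr n δ C (embCov f p)} ≤ ENNReal.ofReal (δ / 3) := by
  have hfL : MemLp f 2 p := MemLp.of_bound hfm.aestronglyMeasurable C hf
  rcases Nat.eq_zero_or_pos d with rfl | hd
  · refine (measure_mono (t := ∅) fun w hw => absurd ?_ hw).trans (by simp)
    rw [Subsingleton.elim (empMean (fun i => f (w i)) - embMean f p) 0, norm_zero]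
    exact Real.sqrt_nonneg _
  have hd' : (0 : ℝ) < d := by exact_mod_cast hd
  have hd1 : (1 : ℝ) ≤ d := by exact_mod_cast hd
  have hn' : (0 : ℝ) < n := by exact_mod_cast hn
  -- Two tails for each of `d` coordinates give `2d · δ / (6d) = δ / 3`. Summing the squared
  -- deviations gives the logarithmic part of `Δ₁²`; its trace part is slack.
  set η := δ / (6 * d) with hη
  have hη0 : 0 < η := by positivity
  have hη1 : η ≤ 1 := by rw [hη, div_le_one (by positivity)]; linarith
  have hηinv : 1 / η = 6 * d / δ := by rw [hη, one_div_div]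
  have hcoord : ∀ i, ∀ᵐ x ∂p, f x i ∈ Set.Icc (-C) C := fun i => by
    filter_upwards [hf] with x hx
    exact abs_le.1 ((PiLp.norm_apply_le (f x) i).trans hx)
  have hcoord' : ∀ i, ∀ᵐ x ∂p, -f x i ∈ Set.Icc (-C) C := fun i => by
    filter_upwards [hcoord i] with x hx
    exact ⟨by linarith [hx.2], by linarith [hx.1]⟩
  have hup := fun i => measure_pi_le_mean_sub_le (p := p) (g := fun x => f x i) (by fun_prop)
    (by linarith) (hcoord i) hη0 hη1 hn
  have hlo := fun i => measure_pi_le_mean_sub_le (p := p) (g := fun x => -f x i) (by fun_prop)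
    (by linarith) (hcoord' i) hη0 hη1 hn
  rw [hηinv] at hup hlo
  set c := (C - -C) * √(1 / (2 * n) * Real.log (6 * d / δ)) with hc
  have hlog := log_six_mul_div_nonneg d hδ0 hδ1
  have hc2 : c ^ 2 = 2 * C ^ 2 / n * Real.log (6 * d / δ) := by
    rw [hc, mul_pow, Real.sq_sqrt (by positivity)]
    field_simp
    ring
  have hbad := measure_iUnion_fintype_le (Measure.pi fun _ : Fin n => p) fun i : Fin d =>
    {w | c ≤ (n : ℝ)⁻¹ * ∑ k, f (w k) i - ∫ x, f x i ∂p} ∪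
      {w | c ≤ (n : ℝ)⁻¹ * ∑ k, -f (w k) i - ∫ x, -f x i ∂p}
  refine le_trans (measure_mono fun w hw => ?_) (hbad.trans ((Finset.sum_le_sum fun i _ =>
    (measure_union_le _ _).trans (add_le_add (hup i) (hlo i))).trans_eq ?_))
  · by_contra hcon
    simp only [Set.mem_iUnion, Set.mem_union, Set.mem_ofPred_eq, not_exists, not_or, not_le]
      at hcon
    refine hw ((sq_le_sq₀ (norm_nonneg _) (Real.sqrt_nonneg _)).1 ?_)
    refine le_of_le_of_eq ?_ (meanErr_sq hδ0 hδ1 C (posSemidef_embCov hfL)).symm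
    rw [EuclideanSpace.norm_sq_eq]
    have hle : ∀ i ∈ Finset.univ, ‖(empMean (fun i => f (w i)) - embMean f p) i‖ ^ 2
        ≤ 2 * C ^ 2 / n * Real.log (6 * d / δ) := by
      intro i _
      obtain ⟨h1, h2⟩ := hcon i
      rw [integral_neg, Finset.sum_neg_distrib] at h2
      have e : (empMean (fun i => f (w i)) - embMean f p) i
          = (n : ℝ)⁻¹ * ∑ k, f (w k) i - ∫ x, f x i ∂p := by
        simp [empMean, embMean_apply hfL]
      rw [e, ← hc2, Real.norm_eq_abs]
      exact pow_le_pow_left₀ (abs_nonneg _) (abs_le.2 ⟨by linarith, h1.le⟩) 2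
    refine (Finset.sum_le_card_nsmul _ _ _ hle).trans ?_
    have := (posSemidef_embCov hfL).trace_nonneg
    have h3 : 0 ≤ (embCov f p).trace / n := by positivity
    simp only [Finset.card_univ, Fintype.card_fin, nsmul_eq_mul]
    calc _ = 2 * d * C ^ 2 / n * Real.log (6 * d / δ) := by ring
      _ ≤ _ := by linarith
  · rw [← ENNReal.ofReal_add hη0.le hη0.le, Finset.sum_const, Finset.card_univ, Fintype.card_fin,
      nsmul_eq_mul, ← ENNReal.ofReal_natCast, ← ENNReal.ofReal_mul (by positivity)]
    congr 1
    rw [hη]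
    field_simp
    norm_num

theorem measure_pi_trace_lt_le {C δ : ℝ} (hfm : Measurable f) (hC : 0 < C)
    (hf : ∀ᵐ x ∂p, ‖f x‖ ≤ C) (hδ0 : 0 < δ) (hδ1 : δ < 1) {n : ℕ} (hn : 0 < n) :
    (Measure.pi fun _ : Fin n => p)
      {w | ¬ (n : ℝ)⁻¹ * ∑ i, ‖f (w i) - embMean f p‖ ^ 2 - (embCov f p).trace
        ≤ 4 * C ^ 2 * √(1 / (2 * n) * Real.log (3 / δ))} ≤ ENNReal.ofReal (δ / 3) := by
  have hfL : MemLp f 2 p := MemLp.of_bound hfm.aestronglyMeasurable C hf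
  have hμ : ‖embMean f p‖ ≤ C := by
    simpa [embMean] using norm_integral_le_of_norm_le_const hf
  have hb : ∀ᵐ x ∂p, ‖f x - embMean f p‖ ^ 2 ∈ Set.Icc 0 (4 * C ^ 2) := by
    filter_upwards [hf] with x hx
    refine ⟨sq_nonneg _, ?_⟩
    have h := (norm_sub_le (f x) (embMean f p)).trans (add_le_add hx hμ)
    calc _ ≤ (C + C) ^ 2 := pow_le_pow_left₀ (norm_nonneg _) h 2
      _ = _ := by ring
  have key := measure_pi_le_mean_sub_le (p := p) (by fun_prop) (by positivity) hb
    (η := δ / 3) (by positivity) (by linarith) hn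
  rw [← trace_embCov hfL, one_div_div, sub_zero] at key
  refine le_trans (measure_mono fun w hw => ?_) key
  exact (not_le.1 hw).le

end

/-! ### Empirical covariance and change of centre -/

section Empirical

variable {d n : ℕ} (v : Fin n → EuclideanSpace ℝ (Fin d)) (u : EuclideanSpace ℝ (Fin d))

theorem sum_sub_empMean (hn : 0 < n) : ∑ i, (v i - u) = (n : ℝ) • (empMean v - u) := by
  have hn' : (n : ℝ) ≠ 0 := by positivity
  rw [Finset.sum_sub_distrib, smul_sub, empMean, smul_smul, mul_inv_cancel₀ hn', one_smul]
  simp [← Nat.cast_smul_eq_nsmul ℝ]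

theorem dotProduct_empCov_mulVec (x : EuclideanSpace ℝ (Fin d)) :
    x.ofLp ⬝ᵥ empCov v *ᵥ x.ofLp = (n : ℝ)⁻¹ * ∑ i, inner ℝ (v i - empMean v) x ^ 2 := by
  rw [empCov, smul_mulVec, dotProduct_smul, smul_eq_mul, sum_mulVec, dotProduct_sum]
  congr 1
  refine Finset.sum_congr rfl fun i _ => ?_
  rw [vecMulVec_mulVec, EuclideanSpace.inner_eq_star_dotProduct]
  simp only [star_trivial, dotProduct_smul, MulOpposite.smul_eq_mul_unop, MulOpposite.unop_op]
  rw [dotProduct_comm (v i - empMean v).ofLp, sq]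

/-- The bias-variance identity in direction `x`: it transfers bounds centred at the true mean to the
empirical covariance. -/
theorem dotProduct_empCov_mulVec_eq (hn : 0 < n) (x : EuclideanSpace ℝ (Fin d)) :
    x.ofLp ⬝ᵥ empCov v *ᵥ x.ofLp
      = (n : ℝ)⁻¹ * ∑ i, inner ℝ (v i - u) x ^ 2 - inner ℝ (empMean v - u) x ^ 2 := by
  have hn' : (n : ℝ) ≠ 0 := by positivity
  have e : ∀ i, inner ℝ (v i - empMean v) x ^ 2 = inner ℝ (v i - u) x ^ 2
      - 2 * inner ℝ (empMean v - u) x * inner ℝ (v i - u) x + inner ℝ (empMean v - u) x ^ 2 := by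
    intro i
    rw [← sub_sub_sub_cancel_right (v i) (empMean v) u, inner_sub_left]
    ring
  have h := congrArg (fun z => inner ℝ z x) (sum_sub_empMean v u hn)
  simp only [sum_inner, inner_smul_left, conj_trivial] at h
  rw [dotProduct_empCov_mulVec]
  simp_rw [e]
  rw [Finset.sum_add_distrib, Finset.sum_sub_distrib, ← Finset.mul_sum, h]
  simp only [Finset.sum_const, Finset.card_univ, Fintype.card_fin, nsmul_eq_mul]
  field_simp
  ring

theorem isSymm_empCov : (empCov v).IsSymm := by
  rw [IsSymm, empCov, transpose_smul, transpose_sum]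
  simp [transpose_vecMulVec]

theorem posSemidef_empCov : (empCov v).PosSemidef := by
  refine .of_dotProduct_mulVec_nonneg ?_ fun x => ?_
  · rw [IsHermitian, conjTranspose_eq_transpose_of_trivial]
    exact isSymm_empCov v
  · have := dotProduct_empCov_mulVec v (WithLp.toLp 2 x)
    simp only [star_trivial]
    rw [this]
    positivity

theorem trace_empCov_le (hn : 0 < n) :
    (empCov v).trace ≤ (n : ℝ)⁻¹ * ∑ i, ‖v i - u‖ ^ 2 := by
  have e : ∀ A : Matrix (Fin d) (Fin d) ℝ, A.trace = ∑ j, (EuclideanSpace.single j (1 : ℝ)).ofLp ⬝ᵥ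
      A *ᵥ (EuclideanSpace.single j (1 : ℝ)).ofLp := fun A => by simp [trace]
  rw [e]
  simp_rw [EuclideanSpace.norm_sq_eq]
  rw [Finset.sum_comm, Finset.mul_sum]
  refine Finset.sum_le_sum fun j _ => ?_
  rw [dotProduct_empCov_mulVec_eq v u hn]
  simp only [EuclideanSpace.inner_single_right, conj_trivial, one_mul, Real.norm_eq_abs, sq_abs]
  linarith [sq_nonneg ((empMean v - u) j)]

end Empirical

/-- The strict positivity demanded by `trace_matSqrt_mul_le`; it comes from the `C²` term of `Δ₁²`,
so it holds even when `S = 0`. -/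
theorem covErr_pos {d n : ℕ} {δ C κ : ℝ} {S : Matrix (Fin d) (Fin d) ℝ} (hd : 0 < d) (hn : 0 < n)
    (hC : 0 < C) (hδ0 : 0 < δ) (hδ1 : δ < 1) (hS : S.PosSemidef) : 0 < covErr n δ C κ S := by
  have hd' : (0 : ℝ) < d := by exact_mod_cast hd
  have hd1 : (1 : ℝ) ≤ d := by exact_mod_cast hd
  have hn' : (0 : ℝ) < n := by exact_mod_cast hn
  have hlog : 0 < Real.log (6 * d / δ) := Real.log_pos (by rw [lt_div_iff₀ hδ0]; linarith)
  have htr := hS.trace_nonneg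
  have h1 : 0 ≤ 20 * κ ^ 2 * specNorm S * √((4 * effRank S + Real.log (3 / δ)) / n) :=
    mul_nonneg (mul_nonneg (by positivity) (specNorm_nonneg S)) (Real.sqrt_nonneg _)
  have h2 : 0 < meanErr n δ C S ^ 2 := by
    rw [meanErr_sq hδ0 hδ1 C hS]
    positivity
  exact add_pos_of_nonneg_of_pos h1 h2

theorem trace_frechet {d : ℕ} (A B M : Matrix (Fin d) (Fin d) ℝ) :
    (A + B - (2 : ℝ) • M).trace = A.trace + B.trace - 2 * M.trace := by
  simp [trace_sub, trace_add, trace_smul]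

/-! ### Deterministic comparison of the two distances -/

section Deterministic

variable {d n : ℕ} {v : Fin n → EuclideanSpace ℝ (Fin d)} {m mr : EuclideanSpace ℝ (Fin d)}
  {S Sr : Matrix (Fin d) (Fin d) ℝ} {δ C κ : ℝ}

theorem trace_matSqrt_mul_le_empCov (hn : 0 < n) (hC : 0 < C) (hδ0 : 0 < δ) (hδ1 : δ < 1)
    (hS : S.PosSemidef) (hSr : Sr.PosDef) (hmean : ‖empMean v - m‖ ≤ meanErr n δ C S)
    (hcov : ∀ x : EuclideanSpace ℝ (Fin d),
      x.ofLp ⬝ᵥ S *ᵥ x.ofLp - (n : ℝ)⁻¹ * ∑ i, inner ℝ (v i - m) x ^ 2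
        ≤ 20 * κ ^ 2 * specNorm S * √((4 * effRank S + Real.log (3 / δ)) / n) * ‖x‖ ^ 2) :
    (matSqrt (S * Sr)).trace
      ≤ (matSqrt (empCov v * Sr)).trace + √(covErr n δ C κ S) * (matSqrt Sr).trace := by
  rcases Nat.eq_zero_or_pos d with rfl | hd
  · simp [trace]
  refine trace_matSqrt_mul_le (covErr_pos hd hn hC hδ0 hδ1 hS) hS (posSemidef_empCov v) hSr ?_
  refine .of_dotProduct_mulVec_nonneg ?_ fun y => ?_
  · rw [IsHermitian, conjTranspose_eq_transpose_of_trivial]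
    simp [(isSymm_empCov v).eq, hS.isSymm]
  · set x : EuclideanSpace ℝ (Fin d) := WithLp.toLp 2 y with hx
    have hyx : y = x.ofLp := rfl
    have hnorm : x.ofLp ⬝ᵥ x.ofLp = ‖x‖ ^ 2 := by
      rw [EuclideanSpace.norm_sq_eq, dotProduct]
      refine Finset.sum_congr rfl fun i _ => ?_
      rw [Real.norm_eq_abs, sq_abs, sq]
    rw [star_trivial, hyx, sub_mulVec, add_mulVec, smul_mulVec, one_mulVec, dotProduct_sub,
      dotProduct_add, dotProduct_smul, smul_eq_mul, hnorm, dotProduct_empCov_mulVec_eq v m hn,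
      covErr]
    have h1 := hcov x
    -- The price of centring at the empirical mean, and the origin of the summand `Δ₁²` in `Δ₂`.
    have h2 : inner ℝ (empMean v - m) x ^ 2 ≤ meanErr n δ C S ^ 2 * ‖x‖ ^ 2 := by
      rw [← mul_pow, ← sq_abs (inner ℝ _ _)]
      refine pow_le_pow_left₀ (abs_nonneg _) ((abs_real_inner_le_norm _ _).trans ?_) 2
      gcongr
    linarith

theorem frechetDist_sub_boundedBonus_le (hn : 0 < n) (hC : 0 < C) (hδ0 : 0 < δ) (hδ1 : δ < 1)
    (hS : S.PosSemidef) (hSr : Sr.PosDef) (hmean : ‖empMean v - m‖ ≤ meanErr n δ C S)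
    (hcov : ∀ x : EuclideanSpace ℝ (Fin d),
      x.ofLp ⬝ᵥ S *ᵥ x.ofLp - (n : ℝ)⁻¹ * ∑ i, inner ℝ (v i - m) x ^ 2
        ≤ 20 * κ ^ 2 * specNorm S * √((4 * effRank S + Real.log (3 / δ)) / n) * ‖x‖ ^ 2)
    (htr : (n : ℝ)⁻¹ * ∑ i, ‖v i - m‖ ^ 2 - S.trace
        ≤ 4 * C ^ 2 * √(1 / (2 * n) * Real.log (3 / δ))) :
    frechetDist (empMean v) (empCov v) mr Sr - boundedBonus n δ C κ (empMean v) S mr Sr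
      ≤ frechetDist m S mr Sr := by
  have h1 := trace_matSqrt_mul_le_empCov hn hC hδ0 hδ1 hS hSr hmean hcov
  have h2 := trace_empCov_le v m hn
  -- The argument yields the factor `√4`, below the `√8` of the bonus.
  have h3 : 2 * √(covErr n δ C κ S) ≤ √(8 * covErr n δ C κ S) := by
    rw [Real.sqrt_mul (by norm_num)]
    gcongr
    exact Real.le_sqrt_of_sq_le (by norm_num)
  have h4 := mul_le_mul_of_nonneg_right h3 (matSqrt_trace_nonneg hSr.posSemidef)
  have h5 : ‖empMean v - mr‖ ≤ ‖empMean v - m‖ + ‖m - mr‖ := norm_sub_le_norm_sub_add_norm_sub ..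
  have h6 : 0 ≤ ‖m - mr‖ := norm_nonneg _
  have h7 : ‖empMean v - mr‖ ^ 2 - ‖m - mr‖ ^ 2
      ≤ 2 * (meanErr n δ C S + ‖empMean v - mr‖) * meanErr n δ C S := by
    have h8 : 0 ≤ ‖empMean v - mr‖ := norm_nonneg _
    have h9 : 0 ≤ meanErr n δ C S := Real.sqrt_nonneg _
    rcases le_total ‖empMean v - mr‖ ‖m - mr‖ with h | h
    · have : 0 ≤ 2 * (meanErr n δ C S + ‖empMean v - mr‖) * meanErr n δ C S := by positivity
      nlinarith
    · have h10 : ‖empMean v - mr‖ - ‖m - mr‖ ≤ meanErr n δ C S := by linarith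
      nlinarith
  simp only [frechetDist, boundedBonus, trace_frechet]
  linarith

end Deterministic

/-! ### Union bound and transfer to the sample space -/

/-- The bound for samples on the product space. -/
theorem measure_pi_not_frechetDist_le {𝒳 : Type*} [MeasurableSpace 𝒳] {d : ℕ}
    {f : 𝒳 → EuclideanSpace ℝ (Fin d)} (hf : Measurable f) {p : Measure 𝒳}
    [IsProbabilityMeasure p] {mr : EuclideanSpace ℝ (Fin d)} {Sr : Matrix (Fin d) (Fin d) ℝ}
    (hSr : Sr.PosDef) {C κ δ : ℝ} (hC : 0 < C) (hbound : ∀ᵐ x ∂p, ‖f x‖ ≤ C)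
    (hκ : IsSubGaussianConst f p κ) (hδ0 : 0 < δ) (hδ1 : δ < 1) {n : ℕ} (hn : 0 < n) :
    (Measure.pi fun _ : Fin n => p) {w | ¬ frechetDist (empMean fun i => f (w i))
        (empCov fun i => f (w i)) mr Sr
        - boundedBonus n δ C κ (empMean fun i => f (w i)) (embCov f p) mr Sr
      ≤ frechetDist (embMean f p) (embCov f p) mr Sr} ≤ ENNReal.ofReal δ := by
  have hfL : MemLp f 2 p := MemLp.of_bound hf.aestronglyMeasurable C hbound
  have h1 := measure_pi_meanErr_lt_le hf hC hbound hδ0 hδ1 hn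
  have h2 := measure_pi_not_embCov_sub_le hf hfL hκ hδ0 hδ1 hn
  have h3 := measure_pi_trace_lt_le hf hC hbound hδ0 hδ1 hn
  refine le_trans (measure_mono ?_) ((measure_union_le _ _).trans (add_le_add
    ((measure_union_le _ _).trans (add_le_add h1 h2)) h3) |>.trans_eq ?_)
  · intro w hw
    by_contra hcon
    simp only [Set.mem_union, Set.mem_ofPred_eq, not_or, not_not] at hcon
    obtain ⟨⟨e1, e2⟩, e3⟩ := hcon
    exact hw (frechetDist_sub_boundedBonus_le hn hC hδ0 hδ1 (posSemidef_embCov hfL) hSr e1 e2 e3)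
  · rw [← ENNReal.ofReal_add (by positivity) (by positivity),
      ← ENNReal.ofReal_add (by positivity) (by positivity)]
    congr 1; ring

theorem mainTheorem5 {𝒳 Ω : Type*} [MeasurableSpace 𝒳] [MeasurableSpace Ω]
    (P : Measure Ω) [IsProbabilityMeasure P] {d : ℕ}
    (f : 𝒳 → EuclideanSpace ℝ (Fin d)) (hf : Measurable f)
    (pg pr : Measure 𝒳) [IsProbabilityMeasure pg] [IsProbabilityMeasure pr]
    (hfr : MemLp f 2 pr) (hSr : (embCov f pr).PosDef)
    (C : ℝ) (hC : 0 < C) (hbound : ∀ᵐ x ∂pg, ‖f x‖ ≤ C)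
    (κ : ℝ) (hκ : IsSubGaussianConst f pg κ)
    (δ : ℝ) (hδ0 : 0 < δ) (hδ1 : δ < 1)
    (n : ℕ) (hn : 0 < n) (X : Fin n → Ω → 𝒳)
    (hlaw : ∀ i, HasLaw (X i) pg P) (hindep : iIndepFun X P) :
    ENNReal.ofReal (1 - δ) ≤
      P {ω | frechetDist (empMean fun i => f (X i ω)) (empCov fun i => f (X i ω))
              (embMean f pr) (embCov f pr)
            - boundedBonus n δ C κ (empMean fun i => f (X i ω)) (embCov f pg)
              (embMean f pr) (embCov f pr)
          ≤ frechetDist (embMean f pg) (embCov f pg) (embMean f pr) (embCov f pr)} := by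
  have hmeas : ∀ i, AEMeasurable (X i) P := fun i => (hlaw i).aemeasurable
  have hmap := (iIndepFun_iff_map_fun_eq_pi_map hmeas).1 hindep
  simp only [(hlaw _).map_eq] at hmap
  -- Only this inequality for preimages and subadditivity are used, both valid for arbitrary sets,
  -- so measurability of the event, and of `matSqrt`, is not needed.
  have hbad := (Measure.le_map_apply (aemeasurable_pi_lambda _ hmeas) _).trans
    (hmap ▸ measure_pi_not_frechetDist_le (mr := embMean f pr) hf hSr hC hbound hκ hδ0 hδ1 hn)
  rw [ENNReal.ofReal_sub _ hδ0.le, ENNReal.ofReal_one, tsub_le_iff_right]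
  calc (1 : ENNReal) = P Set.univ := measure_univ.symm
    _ ≤ _ := measure_mono fun ω _ => (em _ : _ ∨ ¬ _)
    _ ≤ _ := (measure_union_le _ _).trans (add_le_add le_rfl hbad)
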